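/- A party-approval election consists of a finite set $N$ of $n$ voters, a finite nonempty set $P$ of parties, a nonempty ballot $A_i\subseteq P$ for every voter $i\in N$, and a committee size $k\in\mathbb N$. A committee is a map $W:P\to\mathbb N$ of size $|W|=\sum_{p\in P}W(p)$. It is core stable if there is no nonempty $S\subseteq N$ and committee $T:P\to\mathbb N$ with $|T|\le\lfloor k|S|/n\rfloor$ and $\sum_{p\in A_i}T(p)>\sum_{p\in A_i}W(p)$ for all $i\in S$. Local-search PAV (LS-PAV) with threshold $\varepsilon$ is applied to a party-approval election by replacing every party by $k$ clones, all approved by exactly the voters who approve the party. It starts from an arbitrary set $X$ of $k$ clones and, as long as possible, replaces some $c\in X$ by some $c'\notin X$ such that the PAV score $\mathrm{PAV}(X)=\sum_{i\in N}H_{u_i(X)}$ grows by at least $\varepsilon$, where $u_i(X)$ is the number of elements of $X$ that voter $i$ approves and $H_j=\sum_{t=1}^j 1/t$. Its result is the committee that counts the chosen clones of each party. Theorem. Given a party-approval election, where $k$ is encoded in unary, a core-stable committee of size $k$ can be computed in polynomial time; that is, some function that maps every party-approval election to a core-stable committee of size $k$ is computable by a Turing machine in polynomial time. For $k\ge 2$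 the computed committee can be taken to be a possible result of LS-PAV with threshold $\varepsilon=\frac{1}{(1+2(k-1))(k-1)k}$. Moreover, for $k\ge2$ and this $\varepsilon$, every possible result of LS-PAV is core stable, and every execution of LS-PAV makes $O(nk^3\log k)$ swaps, with an absolute constant. -/

import Mathlib

/-! ### Party-approval elections, committees, and the core -/

/-- A party-approval election: voters `0, …, n-1`, parties `0, …, m-1` (at least one party),
a nonempty ballot `ballot i` of approved parties for every voter `i`, and the committee size `k`. -/
structure PartyElection where
  n : ℕ
  m : ℕ
  m_pos : 0 < m
  ballot : Fin n → Finset (Fin m)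
  ballot_nonempty : ∀ i, (ballot i).Nonempty
  k : ℕ

namespace PartyElection

/-- A committee is a multiset of parties: `W p` is the number of seats of party `p`. -/
abbrev Committee (e : PartyElection) : Type := Fin e.m → ℕ

/-- The number of seats of a committee. -/
def size (e : PartyElection) (W : e.Committee) : ℕ := ∑ p, W p

/-- The number of seats of `W` that go to parties approved by voter `i`. -/
def utility (e : PartyElection) (W : e.Committee) (i : Fin e.n) : ℕ := ∑ p ∈ e.ballot i, W p

/-- The quota `⌊k |S| / n⌋` of a group of voters (division of natural numbers rounds down). -/
def quota (e : PartyElection) (S : Finset (Fin e.n)) : ℕ := e.k * S.card / e.n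

/-- Core stability: no nonempty group `S` of voters has a committee `T` of size at most the quota
of `S` that every member of `S` strictly prefers to `W`. -/
def CoreStable (e : PartyElection) (W : e.Committee) : Prop :=
  ¬ ∃ S : Finset (Fin e.n), S.Nonempty ∧
    ∃ T : e.Committee, e.size T ≤ e.quota S ∧ ∀ i ∈ S, e.utility W i < e.utility T i

end PartyElection

/-! ### Local-search PAV for candidate-approval elections -/

namespace CandidateApproval

variable {N C : Type} [Fintype N] [DecidableEq C]

/-- The PAV score of a set `W` of candidates for the ballots `A`. -/
def pavScore (A : N → Finset C) (W : Finset C) : ℚ := ∑ i, harmonic (W ∩ A i).card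

/-- One iteration of local search with threshold `ε`: a member `c` of the committee is replaced by
a candidate `c'` outside of it, and this raises the PAV score by at least `ε`. -/
def LSStep (A : N → Finset C) (ε : ℚ) (W W' : Finset C) : Prop :=
  ∃ c ∈ W, ∃ c' ∉ W, W' = insert c' (W.erase c) ∧ pavScore A W + ε ≤ pavScore A W'

/-- `W` is a possible result of local-search PAV: it is reached by finitely many iterations from
some committee of size `k`, and no further iteration is possible. -/
def IsLSPAVOutcome (A : N → Finset C) (k : ℕ) (ε : ℚ) (W : Finset C) : Prop :=
  ∃ W₀ : Finset C, W₀.card = k ∧ Relation.ReflTransGen (LSStep A ε) W₀ W ∧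
    ∀ W', ¬ LSStep A ε W W'

/-- `w 0, …, w L` is an execution of `L` iterations of local-search PAV, starting from some
committee of size `k`. -/
def IsLSPAVRun (A : N → Finset C) (k : ℕ) (ε : ℚ) (L : ℕ) (w : Fin (L + 1) → Finset C) : Prop :=
  (w 0).card = k ∧ ∀ j : Fin L, LSStep A ε (w j.castSucc) (w j.succ)

end CandidateApproval

namespace PartyElection

/-- The candidate-approval ballots that belong to a party-approval election: every party `p` has
the `k` clones `(p, 0), …, (p, k-1)`, and a voter approves all clones of the parties she approves. -/
def cloneBallot (e : PartyElection) (i : Fin e.n) : Finset (Fin e.m × Fin e.k) :=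
  e.ballot i ×ˢ Finset.univ

/-- The committee over parties that results from counting the chosen clones of each party. -/
def ofClones (e : PartyElection) (X : Finset (Fin e.m × Fin e.k)) : e.Committee :=
  fun p => (X.filter (fun c => c.1 = p)).card

/-- The threshold `1 / ((1 + 2(k-1))(k-1)k)`; it is used for `k ≥ 2` only. -/
def threshold (e : PartyElection) : ℚ :=
  1 / ((1 + 2 * ((e.k : ℚ) - 1)) * ((e.k : ℚ) - 1) * (e.k : ℚ))

/-! ### Encodings as strings -/

/-- An election as a string over the three symbols `some true`, `some false` and the separator
`none`: the committee size in unary, the number of parties in unary, and then one row of `m` bits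
for each voter, which tells the parties that she approves. -/
def encode (e : PartyElection) : List (Option Bool) :=
  List.replicate e.k (some true) ++ none :: (List.replicate e.m (some true) ++ none ::
    (List.ofFn fun i : Fin e.n =>
      (List.ofFn fun p : Fin e.m => some (decide (p ∈ e.ballot i))) ++ [none]).flatten)

end PartyElection

/-- A committee over the parties `0, …, m-1` as a string: the numbers of seats in unary, each
followed by the separator. -/
def encodeCommittee (W : Σ m : ℕ, (Fin m → ℕ)) : List (Option Bool) :=
  (List.ofFn fun p : Fin W.1 => List.replicate (W.2 p) (some true) ++ [none]).flatten

theorem replicate_append_none_cancel (a b : ℕ) (l l' : List (Option Bool))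
    (h : List.replicate a (some true) ++ none :: l = List.replicate b (some true) ++ none :: l') :
    a = b ∧ l = l' := by
  induction a generalizing b with
  | zero => cases b <;> simp_all [List.replicate_succ]
  | succ a ih =>
    cases b with
    | zero => simp [List.replicate_succ] at h
    | succ b =>
      simp only [List.replicate_succ, List.cons_append, List.cons.injEq, true_and] at h
      exact ⟨congrArg _ (ih b h).1, (ih b h).2⟩

/-- Different elections have different encodings. -/
theorem PartyElection.encode_injective : Function.Injective PartyElection.encode := by
  rintro ⟨n, m, hm, A, hA, k⟩ ⟨n', m', hm', A', hA', k'⟩ h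
  simp only [PartyElection.encode] at h
  obtain ⟨rfl, h⟩ := replicate_append_none_cancel _ _ _ _ h
  obtain ⟨rfl, h⟩ := replicate_append_none_cancel _ _ _ _ h
  have hl := congrArg List.length h
  simp only [List.length_flatten, List.map_ofFn, Function.comp_def, List.length_append,
    List.length_ofFn, List.length_singleton, List.ofFn_const, List.sum_replicate,
    smul_eq_mul] at hl
  obtain rfl := Nat.eq_of_mul_eq_mul_right (Nat.succ_pos m) hl
  have h2 := List.eq_iff_flatten_eq.mpr ⟨h, by simp [List.map_ofFn, Function.comp_def]⟩
  have h3 := List.ofFn_injective h2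
  have h4 : A = A' := by
    funext i
    have h5 := List.append_cancel_right (congrFun h3 i)
    have h6 := List.ofFn_injective h5
    ext p
    simpa using congrFun h6 p
  subst h4
  rfl

/-- Different committees have different encodings. -/
theorem encodeCommittee_injective : Function.Injective encodeCommittee := by
  have key : ∀ (m m' : ℕ) (W : Fin m → ℕ) (W' : Fin m' → ℕ),
      encodeCommittee ⟨m, W⟩ = encodeCommittee ⟨m', W'⟩ → List.ofFn W = List.ofFn W' := by
    intro m
    induction m with
    | zero =>
      intro m' W W' h
      cases m' with
      | zero => simp
      | succ m' => simp [encodeCommittee, List.ofFn_succ] at h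
    | succ m ih =>
      intro m' W W' h
      cases m' with
      | zero => simp [encodeCommittee, List.ofFn_succ] at h
      | succ m' =>
        simp only [encodeCommittee, List.ofFn_succ, List.flatten_cons, List.append_assoc,
          List.singleton_append] at h
        obtain ⟨h1, h2⟩ := replicate_append_none_cancel _ _ _ _ h
        rw [List.ofFn_succ, List.ofFn_succ, h1, ih m' (fun i => W i.succ) (fun i => W' i.succ) h2]
  rintro ⟨m, W⟩ ⟨m', W'⟩ h
  have h1 := key m m' W W' h
  exact List.ofFn_inj'.mp h1

/-!
**Core stability.** Let `W` have `k` seats, and let a group of `s` voters prefer a committee `T`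
with `|T| ≤ k s / n`. The marginal contributions (in the PAV score) of the seats of `T`, when they
are added to `W`, sum up to at least `s`, since each member of the group contributes at least
`u_i(T) / (u_i(W) + 1) ≥ 1`. Hence some party `q` has a marginal contribution of at least `n / k`.
After this seat has been added, the removals of the `k` old seats lose together at most `n` minus
this contribution, so that the average swap to `q` gains at least `1 / k ^ 2`
(`coreStable_of_swap`). The threshold of local search is at most `1 / k ^ 2`, and a party that owns
a seat can pass it to any other party in terms of clones. This gives the core stability of the
results, and the bound on the number of swaps follows since the score is at most `n H_k`.

**Polynomial time.** A local search for the exact PAV score would need rational arithmetic. The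
algorithm here maximizes instead the integer `∑ i, ∑ t < u_i, ⌊N ^ 4 / (t + 1)⌋`, where `N` is the
length of the input. A swap changes at most one summand for each voter, so that rounding changes its
gain by at most `n` (`mul_partyScore_swap_le`). At a local maximum of the rounded score every swap
therefore gains at most `n / N ^ 4`, which is less than both `1 / k ^ 2` and the threshold. The
rounded score is less than `N ^ 6`, so `N ^ 6` sweeps, each of which tries all swaps, lead to a
local maximum (`trySwapped_iterate_swept`). As no swap of its clones reaches the threshold, it is
the result of the local search that starts there.

**Turing machines.** The algorithm is written in a language of loop programs over stacks, in which
the only loop is the one with `N` repetitions. Such a program is compiled to a Turing machine with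
several stacks: every nesting depth of loops owns a clock of two stacks with `N` symbols in total,
from one of which a symbol moves to the other at each repetition, and which is rewound after the
loop. All running times are polynomials in `N` by construction (`LoopProg.polyTime`), and it remains
to show what the program computes (`LocalSearch.run_prog`). Numbers are in unary throughout; scores
are compared by counting up along the old committee and down along the new one, and the quotients
are found by moving symbols between two stacks `N ^ 4` times.
-/

/-! ### Loop programs over stacks -/

/-- Loop programs over stacks indexed by `K` with symbols in `Γ`. `mv a b` moves the top symbol of
`a` to `b` if there is one, `ite k p c d` branches on the top symbol of `k`, and `loop c` repeats
`c` as many times as the input has symbols. -/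
inductive LoopProg (K Γ : Type) : Type
  | skip : LoopProg K Γ
  | push (k : K) (a : Γ) : LoopProg K Γ
  | pop (k : K) : LoopProg K Γ
  | mv (a b : K) : LoopProg K Γ
  | ite (k : K) (p : Option Γ → Bool) (c d : LoopProg K Γ) : LoopProg K Γ
  | seq (c d : LoopProg K Γ) : LoopProg K Γ
  | loop (c : LoopProg K Γ) : LoopProg K Γ

namespace LoopProg

variable {K Γ : Type}

/-- The effect of a loop program on the stacks, where each loop is repeated `N` times. -/
def run [DecidableEq K] (N : ℕ) : LoopProg K Γ → (K → List Γ) → (K → List Γ)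
  | skip, S => S
  | push k a, S => Function.update S k (a :: S k)
  | pop k, S => Function.update S k (S k).tail
  | mv a b, S =>
    match S a with
    | [] => S
    | x :: l => Function.update (Function.update S a l) b (x :: Function.update S a l b)
  | ite k p c d, S => if p (S k).head? then run N c S else run N d S
  | seq c d, S => run N d (run N c S)
  | loop c, S => (run N c)^[N] S

/-- The nesting depth of the loops of a program. -/
def depth : LoopProg K Γ → ℕ
  | ite _ _ c d => max (depth c) (depth d)
  | seq c d => max (depth c) (depth d)
  | loop c => depth c + 1
  | _ => 0

/-- A bound for the number of steps of the compiled program, as a polynomial in the number of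
repetitions of a loop. -/
noncomputable def cost : LoopProg K Γ → Polynomial ℕ
  | ite _ _ c d => 1 + cost c + cost d
  | seq c d => cost c + cost d
  | loop c => Polynomial.X * (cost c + 1) + 1 + (Polynomial.X + 1)
  | _ => 1

/-- The labels of the compiled program. A loop has two labels in addition to those of its body:
`false` is its head and `true` rewinds its clock. -/
def Lab : LoopProg K Γ → Type
  | ite _ _ c d => Option (Lab c ⊕ Lab d)
  | seq c d => Lab c ⊕ Lab d
  | loop c => Bool ⊕ Lab c
  | _ => Unit

instance Lab.fintype : ∀ c : LoopProg K Γ, Fintype (Lab c)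
  | skip => inferInstanceAs (Fintype Unit)
  | push _ _ => inferInstanceAs (Fintype Unit)
  | pop _ => inferInstanceAs (Fintype Unit)
  | mv _ _ => inferInstanceAs (Fintype Unit)
  | ite _ _ c d =>
    letI := Lab.fintype c
    letI := Lab.fintype d
    inferInstanceAs (Fintype (Option (Lab c ⊕ Lab d)))
  | seq c d =>
    letI := Lab.fintype c
    letI := Lab.fintype d
    inferInstanceAs (Fintype (Lab c ⊕ Lab d))
  | loop c =>
    letI := Lab.fintype c
    inferInstanceAs (Fintype (Bool ⊕ Lab c))

/-- The label at which the compiled program starts. -/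
def entry : ∀ c : LoopProg K Γ, Lab c
  | skip => ()
  | push _ _ => ()
  | pop _ => ()
  | mv _ _ => ()
  | ite _ _ _ _ => none
  | seq c _ => Sum.inl (entry c)
  | loop _ => Sum.inl false

/-- The stacks of the compiled program: those of the program, and for every nesting depth a clock
that consists of two stacks; `false` holds the remaining ticks and `true` the elapsed ones. -/
abbrev Stk (K : Type) (D : ℕ) : Type := K ⊕ Fin D × Bool

/-- Compilation to the statements of a stack Turing machine. The labels of the program are embedded
by `emb` into those of the machine, and the code jumps to `exit` at the end. -/
def code {D : ℕ} {Λ : Type} [Inhabited Γ] : ∀ (c : LoopProg K Γ), c.depth ≤ D → (Lab c → Λ) → Λ →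
    Lab c → Turing.TM2.Stmt (fun _ : Stk K D => Γ) Λ (Option Γ)
  | skip, _, _, exit, _ => .goto fun _ => exit
  | push k a, _, _, exit, _ => .push (Sum.inl k) (fun _ => a) (.goto fun _ => exit)
  | pop k, _, _, exit, _ => .pop (Sum.inl k) (fun v _ => v) (.goto fun _ => exit)
  | mv a b, _, _, exit, _ =>
    .pop (Sum.inl a) (fun _ t => t)
      (.branch Option.isSome
        (.push (Sum.inl b) (fun v => v.getD default) (.goto fun _ => exit))
        (.goto fun _ => exit))
  | ite k p c d, hD, emb, exit, l =>
    match l with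
    | none => .peek (Sum.inl k) (fun _ t => t)
        (.branch p (.goto fun _ => emb (some (Sum.inl (entry c))))
          (.goto fun _ => emb (some (Sum.inr (entry d)))))
    | some (Sum.inl l) =>
      code c ((le_max_left _ _).trans hD) (fun l => emb (some (Sum.inl l))) exit l
    | some (Sum.inr l) =>
      code d ((le_max_right _ _).trans hD) (fun l => emb (some (Sum.inr l))) exit l
  | seq c d, hD, emb, exit, l =>
    match l with
    | Sum.inl l =>
      code c ((le_max_left _ _).trans hD) (fun l => emb (Sum.inl l)) (emb (Sum.inr (entry d))) l
    | Sum.inr l => code d ((le_max_right _ _).trans hD) (fun l => emb (Sum.inr l)) exit l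
  | loop c, hD, emb, exit, l =>
    match l with
    | Sum.inl false =>
      .pop (Sum.inr (⟨depth c, hD⟩, false)) (fun _ t => t)
        (.branch Option.isSome
          (.push (Sum.inr (⟨depth c, hD⟩, true)) (fun _ => default)
            (.goto fun _ => emb (Sum.inr (entry c))))
          (.goto fun _ => emb (Sum.inl true)))
    | Sum.inl true =>
      .pop (Sum.inr (⟨depth c, hD⟩, true)) (fun _ t => t)
        (.branch Option.isSome
          (.push (Sum.inr (⟨depth c, hD⟩, false)) (fun _ => default)
            (.goto fun _ => emb (Sum.inl true)))
          (.goto fun _ => exit))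
    | Sum.inr l =>
      code c ((Nat.le_succ _).trans hD) (fun l => emb (Sum.inr l)) (emb (Sum.inl false)) l

end LoopProg

/-! ### Correctness of the compilation -/

/-- `f` leads from `a` to `b` in at most `n` steps. -/
def ReachesWithin {α : Type*} (f : α → Option α) (n : ℕ) (a b : α) : Prop :=
  ∃ t ≤ n, (flip bind f)^[t] (some a) = some b

namespace ReachesWithin

variable {α : Type*} {f : α → Option α} {a b c : α} {m n : ℕ}

theorem single (h : f a = some b) : ReachesWithin f 1 a b := ⟨1, le_rfl, h⟩

theorem trans (h₁ : ReachesWithin f m a b) (h₂ : ReachesWithin f n b c) :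
    ReachesWithin f (m + n) a c := by
  obtain ⟨t, ht, h⟩ := h₁
  obtain ⟨u, hu, h'⟩ := h₂
  refine ⟨u + t, by omega, ?_⟩
  rw [Function.iterate_add_apply, h, h']

theorem mono (h : ReachesWithin f m a b) (hmn : m ≤ n) : ReachesWithin f n a b := by
  obtain ⟨t, ht, h⟩ := h
  exact ⟨t, ht.trans hmn, h⟩

end ReachesWithin

namespace LoopProg

variable {K Γ : Type} [DecidableEq K] [Inhabited Γ] {D : ℕ} {Λ : Type}

/-- The clocks of depth less than `d` show `N` remaining ticks. -/
def ClocksReady (N d : ℕ) (C : Fin D × Bool → List Γ) : Prop :=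
  ∀ j : Fin D, j.1 < d → C (j, false) = List.replicate N default ∧ C (j, true) = []

theorem ClocksReady.mono {N d d' : ℕ} {C : Fin D × Bool → List Γ} (h : ClocksReady N d C)
    (hd : d' ≤ d) : ClocksReady N d' C := fun j hj => h j (hj.trans_le hd)

/-- The clocks `C` after the clock `j` has been set to `r` remaining and `s` elapsed ticks. -/
def setClock (C : Fin D × Bool → List Γ) (j : Fin D) (r s : ℕ) : Fin D × Bool → List Γ :=
  Function.update (Function.update C (j, false) (List.replicate r default)) (j, true)
    (List.replicate s default)

theorem setClock_tick (C : Fin D × Bool → List Γ) (j : Fin D) (r s r' s' : ℕ) :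
    setClock (setClock C j r s) j r' s' = setClock C j r' s' := by
  funext x
  simp only [setClock, Function.update_apply]
  split_ifs <;> rfl

theorem setClock_false (C : Fin D × Bool → List Γ) (j : Fin D) (r s : ℕ) :
    setClock C j r s (j, false) = List.replicate r default := by
  simp [setClock]

theorem setClock_true (C : Fin D × Bool → List Γ) (j : Fin D) (r s : ℕ) :
    setClock C j r s (j, true) = List.replicate s default := by
  simp [setClock]

theorem setClock_self {N d : ℕ} {C : Fin D × Bool → List Γ} (h : ClocksReady N d C) (j : Fin D)
    (hj : j.1 < d) : setClock C j N 0 = C := by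
  funext x
  obtain ⟨h1, h2⟩ := h j hj
  simp only [setClock, Function.update_apply]
  split_ifs with h3 h4
  · rw [h3, h2]; rfl
  · rw [h4, h1]
  · rfl

theorem ClocksReady.setClock {N d : ℕ} {C : Fin D × Bool → List Γ} (h : ClocksReady N d C)
    (j : Fin D) (hj : d ≤ j.1) (r s : ℕ) : ClocksReady N d (setClock C j r s) := by
  intro i hi
  have : i ≠ j := by rintro rfl; omega
  simpa [LoopProg.setClock, this] using h i hi

theorem setClock_update (C : Fin D × Bool → List Γ) (j : Fin D) (r s r' s' : ℕ) :
    Function.update (Function.update (setClock C j r s) (j, false) (List.replicate r' default))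
      (j, true) (List.replicate s' default) = setClock C j r' s' := by
  rw [← setClock_tick C j r s r' s']; rfl

theorem step_code {M : Λ → Turing.TM2.Stmt (fun _ : Stk K D => Γ) Λ (Option Γ)}
    {c : LoopProg K Γ} {hD : c.depth ≤ D} {emb : Lab c → Λ} {exit : Λ}
    (hM : ∀ l, M (emb l) = code c hD emb exit l) (l : Lab c) (v : Option Γ)
    (S : Stk K D → List Γ) :
    Turing.TM2.step M ⟨some (emb l), v, S⟩ =
      some (Turing.TM2.stepAux (code c hD emb exit l) v S) := by
  rw [Turing.TM2.step, hM]

/-- The compiled program has the effect of the program, leaves the clocks as they were, and is as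
fast as `cost` promises. -/
theorem code_reaches {M : Λ → Turing.TM2.Stmt (fun _ : Stk K D => Γ) Λ (Option Γ)} (N : ℕ)
    (c : LoopProg K Γ) : ∀ (hD : c.depth ≤ D) (emb : Lab c → Λ) (exit : Λ),
    (∀ l, M (emb l) = code c hD emb exit l) → ∀ (S : K → List Γ) (C : Fin D × Bool → List Γ),
    ClocksReady N c.depth C → ∀ v, ∃ v', ReachesWithin (Turing.TM2.step M) (c.cost.eval N)
      ⟨some (emb (entry c)), v, Sum.elim S C⟩ ⟨some exit, v', Sum.elim (run N c S) C⟩ := by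
  induction c with
  | skip =>
    intro hD emb exit hM S C hC v
    refine ⟨v, ?_⟩
    simp only [cost, Polynomial.eval_one]
    exact .single ((step_code hM _ _ _).trans (by
      simp [-Sum.elim_update_left, -Sum.elim_update_right, code, run]))
  | push k a =>
    intro hD emb exit hM S C hC v
    refine ⟨v, ?_⟩
    simp only [cost, Polynomial.eval_one]
    exact .single ((step_code hM _ _ _).trans (by
      simp [-Sum.elim_update_left, -Sum.elim_update_right, code, run]))
  | pop k =>
    intro hD emb exit hM S C hC v
    refine ⟨v, ?_⟩
    simp only [cost, Polynomial.eval_one]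
    exact .single ((step_code hM _ _ _).trans (by
      simp [-Sum.elim_update_left, -Sum.elim_update_right, code, run]))
  | mv a b =>
    intro hD emb exit hM S C hC v
    refine ⟨(S a).head?, ?_⟩
    simp only [cost, Polynomial.eval_one]
    refine .single ((step_code hM _ _ _).trans ?_)
    cases h : S a with
    | nil =>
      have : Function.update S a [] = S := by rw [← h, Function.update_eq_self]
      simp [-Sum.elim_update_left, -Sum.elim_update_right, code, run, h, this]
    | cons x l => simp [-Sum.elim_update_left, -Sum.elim_update_right, code, run, h]
  | ite k p c d ihc ihd =>
    intro hD emb exit hM S C hC v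
    simp only [cost, Polynomial.eval_one, Polynomial.eval_add]
    have h0 : Turing.TM2.step M ⟨some (emb (entry (ite k p c d))), v, Sum.elim S C⟩ =
        some ⟨some (if p (S k).head? then emb (some (Sum.inl (entry c)))
          else emb (some (Sum.inr (entry d)))), (S k).head?, Sum.elim S C⟩ := by
      refine (step_code hM _ _ _).trans ?_
      cases h : p (S k).head? <;>
        simp [-Sum.elim_update_left, -Sum.elim_update_right, code, entry, h]
    cases h : p (S k).head? with
    | true =>
      obtain ⟨v', hv⟩ := ihc ((le_max_left _ _).trans hD) (fun l => emb (some (Sum.inl l))) exit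
        (fun l => hM _) S C (hC.mono (le_max_left _ _)) (S k).head?
      simp only [h, if_true] at h0
      refine ⟨v', ?_⟩
      simp only [run, h, if_true]
      exact ((ReachesWithin.single h0).trans hv).mono (by omega)
    | false =>
      obtain ⟨v', hv⟩ := ihd ((le_max_right _ _).trans hD) (fun l => emb (some (Sum.inr l))) exit
        (fun l => hM _) S C (hC.mono (le_max_right _ _)) (S k).head?
      simp only [h, Bool.false_eq_true, if_false] at h0
      refine ⟨v', ?_⟩
      simp only [run, h, Bool.false_eq_true, if_false]
      exact ((ReachesWithin.single h0).trans hv).mono (by omega)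
  | seq c d ihc ihd =>
    intro hD emb exit hM S C hC v
    simp only [cost, Polynomial.eval_add]
    obtain ⟨v', hv⟩ := ihc ((le_max_left _ _).trans hD) (fun l => emb (Sum.inl l))
      (emb (Sum.inr (entry d))) (fun l => hM _) S C (hC.mono (le_max_left _ _)) v
    obtain ⟨v'', hv'⟩ := ihd ((le_max_right _ _).trans hD) (fun l => emb (Sum.inr l)) exit
      (fun l => hM _) (run N c S) C (hC.mono (le_max_right _ _)) v'
    exact ⟨v'', hv.trans hv'⟩
  | loop c ih =>
    intro hD emb exit hM S C hC v
    simp only [cost, Polynomial.eval_add, Polynomial.eval_mul, Polynomial.eval_X,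
      Polynomial.eval_one]
    set j : Fin D := ⟨depth c, hD⟩ with hj
    have ticks : ∀ (r s : ℕ) (S : K → List Γ) (v : Option Γ), ∃ v',
        ReachesWithin (Turing.TM2.step M) (r * (c.cost.eval N + 1) + 1)
        ⟨some (emb (Sum.inl false)), v, Sum.elim S (setClock C j r s)⟩
        ⟨some (emb (Sum.inl true)), v', Sum.elim ((run N c)^[r] S) (setClock C j 0 (r + s))⟩ := by
      intro r
      induction r with
      | zero =>
        intro s S v
        refine ⟨none, ReachesWithin.mono (.single ((step_code hM (Sum.inl false) _ _).trans ?_))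
          (Nat.le_add_left _ _)⟩
        have h2 : Function.update (setClock C j 0 s) (j, false) [] = setClock C j 0 s := by
          conv_rhs => rw [← Function.update_eq_self (j, false) (setClock C j 0 s)]
          rw [setClock_false]; rfl
        simp [-Sum.elim_update_left, -Sum.elim_update_right, code, ← hj, setClock_false, h2]
      | succ r ihr =>
        intro s S v
        have h1 : Turing.TM2.step M
            ⟨some (emb (Sum.inl false)), v, Sum.elim S (setClock C j (r + 1) s)⟩ =
            some ⟨some (emb (Sum.inr (entry c))), some default,
              Sum.elim S (setClock C j r (s + 1))⟩ := by
          refine (step_code hM (Sum.inl false) _ _).trans ?_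
          have := setClock_update C j (r + 1) s r (s + 1)
          simp [-Sum.elim_update_left, -Sum.elim_update_right, code, ← hj, setClock_false,
            setClock_true, List.replicate_succ] at this ⊢
          exact congrArg (Sum.elim S) this
        obtain ⟨v', hv⟩ := ih ((Nat.le_succ _).trans hD) (fun l => emb (Sum.inr l))
          (emb (Sum.inl false)) (fun l => hM _) S _
          ((hC.mono (Nat.le_succ _)).setClock j le_rfl r (s + 1)) (some default)
        obtain ⟨v'', hv'⟩ := ihr (s + 1) (run N c S) v'
        refine ⟨v'', ?_⟩
        rw [Function.iterate_succ_apply, show r + 1 + s = r + (s + 1) by omega]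
        refine ((ReachesWithin.single h1).trans (hv.trans hv')).mono ?_
        rw [Nat.succ_mul]; omega
    have rewind : ∀ (s r : ℕ) (S : K → List Γ) (v : Option Γ), ∃ v',
        ReachesWithin (Turing.TM2.step M) (s + 1)
        ⟨some (emb (Sum.inl true)), v, Sum.elim S (setClock C j r s)⟩
        ⟨some exit, v', Sum.elim S (setClock C j (r + s) 0)⟩ := by
      intro s
      induction s with
      | zero =>
        intro r S v
        refine ⟨none, ReachesWithin.single ((step_code hM (Sum.inl true) _ _).trans ?_)⟩
        have h2 : Function.update (setClock C j r 0) (j, true) [] = setClock C j r 0 := by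
          conv_rhs => rw [← Function.update_eq_self (j, true) (setClock C j r 0)]
          rw [setClock_true]; rfl
        simp [-Sum.elim_update_left, -Sum.elim_update_right, code, ← hj, setClock_true, h2]
      | succ s ihs =>
        intro r S v
        have h1 : Turing.TM2.step M
            ⟨some (emb (Sum.inl true)), v, Sum.elim S (setClock C j r (s + 1))⟩ =
            some ⟨some (emb (Sum.inl true)), some default,
              Sum.elim S (setClock C j (r + 1) s)⟩ := by
          refine (step_code hM (Sum.inl true) _ _).trans ?_
          have := setClock_update C j r (s + 1) (r + 1) s
          rw [Function.update_comm (by simp)] at this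
          simp [-Sum.elim_update_left, -Sum.elim_update_right, code, ← hj, setClock_false,
            setClock_true, List.replicate_succ] at this ⊢
          exact congrArg (Sum.elim S) this
        obtain ⟨v', hv⟩ := ihs (r + 1) S (some default)
        refine ⟨v', ?_⟩
        rw [show r + (s + 1) = r + 1 + s by omega]
        exact ((ReachesWithin.single h1).trans hv).mono (by omega)
    have hset := setClock_self hC j (Nat.lt_succ_self _)
    obtain ⟨v', hv⟩ := ticks N 0 S v
    obtain ⟨v'', hv'⟩ := rewind N 0 ((run N c)^[N] S) v'
    rw [Nat.zero_add] at hv'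
    rw [hset] at hv hv'
    exact ⟨v'', hv.trans hv'⟩

end LoopProg

/-! ### The Turing machine of a loop program -/

namespace LoopProg

variable {K Γ : Type} [DecidableEq K] {D : ℕ} {Λ : Type}

/-- The statement that removes a tick from each of the given clocks; the register then tells
whether there was one. -/
def popClocks (l : List (Fin D)) (q : Turing.TM2.Stmt (fun _ : Stk K D => Γ) Λ (Option Γ)) :
    Turing.TM2.Stmt (fun _ : Stk K D => Γ) Λ (Option Γ) :=
  l.foldr (fun j q => .pop (Sum.inr (j, false)) (fun _ t => t) q) q

theorem stepAux_popClocks (q : Turing.TM2.Stmt (fun _ : Stk K D => Γ) Λ (Option Γ))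
    (S : K → List Γ) (x : Option Γ) (l : List (Fin D)) : l.Nodup →
    ∀ (v : Option Γ) (C : Fin D × Bool → List Γ), (∀ j ∈ l, (C (j, false)).head? = x) →
    Turing.TM2.stepAux (popClocks l q) v (Sum.elim S C) =
      Turing.TM2.stepAux q (if l = [] then v else x)
        (Sum.elim S fun p => if p.1 ∈ l ∧ p.2 = false then (C p).tail else C p) := by
  induction l with
  | nil => intro _ v C _; simp [popClocks]
  | cons j l ih =>
    intro hl v C hC
    have h1 : Turing.TM2.stepAux (popClocks (j :: l) q) v (Sum.elim S C) =
        Turing.TM2.stepAux (popClocks l q) x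
          (Sum.elim S (Function.update C (j, false) (C (j, false)).tail)) := by
      rw [← Sum.update_elim_inr, ← hC j List.mem_cons_self]; rfl
    have hj := (List.nodup_cons.mp hl).1
    rw [h1, ih hl.of_cons]
    · simp only [ite_self, reduceCtorEq, if_false]
      congr 2
      funext ⟨i, b⟩
      by_cases hi : i = j
      · subst hi
        cases b <;> simp [hj]
      · simp [hi]
    · intro i hi
      have : i ≠ j := by rintro rfl; exact hj hi
      simpa [this] using hC i (List.mem_cons_of_mem _ hi)

variable [Inhabited Γ]

/-- The statement that adds a tick to each of the given clocks. -/
def pushClocks (l : List (Fin D)) (q : Turing.TM2.Stmt (fun _ : Stk K D => Γ) Λ (Option Γ)) :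
    Turing.TM2.Stmt (fun _ : Stk K D => Γ) Λ (Option Γ) :=
  l.foldr (fun j q => .push (Sum.inr (j, false)) (fun _ => default) q) q

/-- All clocks show `N` remaining ticks. -/
def fullClocks (N : ℕ) : Fin D × Bool → List Γ :=
  fun p => if p.2 then [] else List.replicate N default

theorem stepAux_pushClocks (q : Turing.TM2.Stmt (fun _ : Stk K D => Γ) Λ (Option Γ))
    (v : Option Γ) (S : K → List Γ) (l : List (Fin D)) : l.Nodup → ∀ C : Fin D × Bool → List Γ,
    Turing.TM2.stepAux (pushClocks l q) v (Sum.elim S C) =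
      Turing.TM2.stepAux q v
        (Sum.elim S fun p => if p.1 ∈ l ∧ p.2 = false then default :: C p else C p) := by
  induction l with
  | nil => intro _ C; simp [pushClocks]
  | cons j l ih =>
    intro hl C
    have h1 : Turing.TM2.stepAux (pushClocks (j :: l) q) v (Sum.elim S C) =
        Turing.TM2.stepAux (pushClocks l q) v
          (Sum.elim S (Function.update C (j, false) (default :: C (j, false)))) := by
      rw [← Sum.update_elim_inr]; rfl
    rw [h1, ih hl.of_cons]
    congr 2
    funext ⟨i, b⟩
    have hj := (List.nodup_cons.mp hl).1
    by_cases hi : i = j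
    · subst hi
      cases b <;> simp [hj]
    · simp [hi]

/-- The code of the Turing machine of a loop program. It moves the input from the stack `inp` to the
stack `tmp`, which reverses it, and winds the clocks; it then runs the program and empties the
clocks. -/
def machineCode (c : LoopProg K Γ) (inp tmp : K) :
    Bool ⊕ Lab c → Turing.TM2.Stmt (fun _ : Stk K c.depth => Γ) (Bool ⊕ Lab c) (Option Γ)
  | Sum.inl false =>
    .pop (Sum.inl inp) (fun _ t => t)
      (.branch Option.isSome
        (.push (Sum.inl tmp) (fun v => v.getD default)
          (pushClocks (List.finRange c.depth) (.goto fun _ => Sum.inl false)))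
        (.goto fun _ => Sum.inr (entry c)))
  | Sum.inl true =>
    .load (fun _ => none) (popClocks (List.finRange c.depth)
      (.branch Option.isSome (.goto fun _ => Sum.inl true) .halt))
  | Sum.inr l => code c le_rfl Sum.inr (Sum.inl true) l

theorem machineCode_read (c : LoopProg K Γ) {inp tmp : K} (hne : inp ≠ tmp) :
    ∀ (l r : List Γ) (n : ℕ) (v : Option Γ),
      ReachesWithin (Turing.TM2.step (machineCode c inp tmp)) (l.length + 1)
        ⟨some (Sum.inl false), v, Sum.elim (Function.update (Function.update (fun _ => []) tmp r)
          inp l) (fullClocks n)⟩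
        ⟨some (Sum.inr (entry c)), none, Sum.elim (Function.update (fun _ => []) tmp
          (l.reverse ++ r)) (fullClocks (l.length + n))⟩ := by
  intro l
  induction l with
  | nil =>
    intro r n v
    refine ReachesWithin.mono (.single ?_) (Nat.le_add_left _ _)
    have e : Function.update (Function.update (fun _ => []) tmp r) inp ([] : List Γ) =
        Function.update (fun _ => []) tmp r := by
      funext k
      simp only [Function.update_apply]
      split_ifs with h1 h2 <;> simp_all
    simp [-Sum.elim_update_left, -Sum.elim_update_right, machineCode, hne, e]
  | cons x l ih =>
    intro r n v
    have h1 : Turing.TM2.step (machineCode c inp tmp) ⟨some (Sum.inl false), v, Sum.elim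
        (Function.update (Function.update (fun _ => []) tmp r) inp (x :: l)) (fullClocks n)⟩ =
        some ⟨some (Sum.inl false), some x, Sum.elim (Function.update
        (Function.update (fun _ => []) tmp (x :: r)) inp l) (fullClocks (n + 1))⟩ := by
      have e : Function.update (Function.update (Function.update (fun _ => []) tmp r) inp l) tmp
          (x :: r) = Function.update (Function.update (fun _ => []) tmp (x :: r)) inp l := by
        rw [Function.update_comm hne, Function.update_idem]
      have e' : (fun p : Fin c.depth × Bool => if p.2 = false then default :: fullClocks n p
          else fullClocks n p) = (fullClocks (n + 1) : Fin c.depth × Bool → List Γ) := by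
        funext ⟨i, b⟩
        cases b <;> simp [fullClocks, List.replicate_succ]
      simp [-Sum.elim_update_left, -Sum.elim_update_right, machineCode, hne.symm, e,
        stepAux_pushClocks _ _ _ _ (List.nodup_finRange _), e']
    have h2 := (ReachesWithin.single h1).trans (ih (x :: r) (n + 1) (some x))
    rw [List.reverse_cons, List.append_assoc, List.singleton_append, List.length_cons,
      show l.length + 1 + n = l.length + (n + 1) by omega]
    exact h2.mono (by omega)

theorem machineCode_drain (c : LoopProg K Γ) (inp tmp : K) :
    ∀ (n : ℕ) (S : K → List Γ) (v : Option Γ),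
      ReachesWithin (Turing.TM2.step (machineCode c inp tmp)) (n + 1)
        ⟨some (Sum.inl true), v, Sum.elim S (fullClocks n)⟩
        ⟨none, none, Sum.elim S fun _ => []⟩ := by
  intro n
  induction n with
  | zero =>
    intro S v
    refine .single ?_
    have e : (fun p : Fin c.depth × Bool => if p.2 = false then (fullClocks 0 p).tail
        else fullClocks 0 p) = fun _ => ([] : List Γ) := by
      funext ⟨i, b⟩
      cases b <;> simp [fullClocks]
    refine congrArg some ((stepAux_popClocks _ S none _ (List.nodup_finRange _) none (fullClocks 0)
      (fun j _ => by simp [fullClocks])).trans ?_)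
    simp [-Sum.elim_update_left, -Sum.elim_update_right, e]
  | succ n ih =>
    intro S v
    rcases Nat.eq_zero_or_pos c.depth with h0 | h0
    · -- without clocks there is nothing to drain
      refine ReachesWithin.mono (.single ?_) (Nat.le_add_left _ _)
      have : IsEmpty (Fin c.depth × Bool) := by rw [h0]; infer_instance
      have e : (fullClocks (n + 1) : Fin c.depth × Bool → List Γ) = fun _ => [] :=
        Subsingleton.elim _ _
      rw [e]
      have e2 : List.finRange c.depth = [] := by
        rw [List.eq_nil_iff_length_eq_zero, List.length_finRange, h0]
      simp [machineCode, e2, popClocks]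
    · have h1 : Turing.TM2.step (machineCode c inp tmp)
            ⟨some (Sum.inl true), v, Sum.elim S (fullClocks (n + 1))⟩ =
          some ⟨some (Sum.inl true), some default, Sum.elim S (fullClocks n)⟩ := by
        have e : (fun p : Fin c.depth × Bool => if p.2 = false then (fullClocks (n + 1) p).tail
            else fullClocks (n + 1) p) = (fullClocks n : Fin c.depth × Bool → List Γ) := by
          funext ⟨i, b⟩
          cases b <;> simp [fullClocks]
        have e2 : List.finRange c.depth ≠ [] := by
          rw [Ne, List.eq_nil_iff_length_eq_zero, List.length_finRange]
          exact h0.ne'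
        refine congrArg some ((stepAux_popClocks _ S (some default) _ (List.nodup_finRange _) none
          (fullClocks (n + 1)) (fun j _ => by simp [fullClocks, List.replicate_succ])).trans ?_)
        simp [-Sum.elim_update_left, -Sum.elim_update_right, e, e2]
      exact ((ReachesWithin.single h1).trans (ih S (some default))).mono (by omega)

/-- The Turing machine of a loop program, with input stack `inp` and output stack `out`. -/
def machine [Fintype K] [Fintype Γ] (c : LoopProg K Γ) (inp tmp out : K) : Turing.FinTM2 where
  K := Stk K c.depth
  k₀ := Sum.inl inp
  k₁ := Sum.inl out
  Γ := fun _ => Γ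
  Λ := Bool ⊕ Lab c
  main := Sum.inl false
  σ := Option Γ
  initialState := none
  m := machineCode c inp tmp

theorem initList_stk_self (tm : Turing.FinTM2) (l : List (tm.Γ tm.k₀)) :
    (Turing.initList tm l).stk tm.k₀ = l := by
  simp [Turing.initList]

theorem initList_stk_of_ne (tm : Turing.FinTM2) (l : List (tm.Γ tm.k₀)) {k : tm.K}
    (h : k ≠ tm.k₀) : (Turing.initList tm l).stk k = [] := by
  simp [Turing.initList, h]

theorem haltList_stk_self (tm : Turing.FinTM2) (l : List (tm.Γ tm.k₁)) :
    (Turing.haltList tm l).stk tm.k₁ = l := by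
  simp [Turing.haltList]

theorem haltList_stk_of_ne (tm : Turing.FinTM2) (l : List (tm.Γ tm.k₁)) {k : tm.K}
    (h : k ≠ tm.k₁) : (Turing.haltList tm l).stk k = [] := by
  simp [Turing.haltList, h]

/-- A function that is computed by a loop program, where the loops are repeated as often as the
input has symbols, is computable in polynomial time. -/
theorem polyTime [Fintype K] [Fintype Γ] {α β : Type} {ea : α → List Γ} {eb : β → List Γ}
    {f : α → β} (c : LoopProg K Γ) {inp tmp : K} (out : K) (hne : inp ≠ tmp)
    (h : ∀ a, run (ea a).length c (Function.update (fun _ => []) tmp (ea a).reverse) =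
      Function.update (fun _ => []) out (eb (f a))) :
    Nonempty (Turing.TM2ComputableInPolyTime ea eb f) := by
  have main : ∀ (a : α) (l o : List Γ), l = ea a → o = eb (f a) →
      ReachesWithin (machine c inp tmp out).step (((Polynomial.X + 1) + c.cost +
        (Polynomial.X + 1)).eval (ea a).length) (Turing.initList (machine c inp tmp out) l)
        (Turing.haltList (machine c inp tmp out) o) := by
    rintro a l o rfl rfl
    obtain ⟨v, hv⟩ := code_reaches (M := machineCode c inp tmp) (ea a).length c le_rfl Sum.inr
      (Sum.inl true) (fun l => rfl) (Function.update (fun _ => []) tmp (ea a).reverse)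
      (fullClocks (ea a).length) (fun j _ => ⟨rfl, rfl⟩) none
    have h1 := machineCode_read c hne (ea a) [] 0 none
    have h3 := machineCode_drain c inp tmp (ea a).length (run (ea a).length c
      (Function.update (fun _ => []) tmp (ea a).reverse)) v
    rw [List.append_nil] at h1
    have h4 := (h1.trans hv).trans h3
    have e1 : Sum.elim (Function.update (Function.update (fun _ => []) tmp []) inp (ea a))
        (fullClocks 0) = (Turing.initList (machine c inp tmp out) (ea a)).stk := by
      funext k
      rcases k with k | ⟨i, b⟩
      · by_cases hk : k = inp
        · subst hk
          exact (Function.update_self _ _ _).trans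
            (initList_stk_self (machine c k tmp out) (ea a)).symm
        · refine Eq.trans ?_ (initList_stk_of_ne (machine c inp tmp out) (ea a)
            (k := Sum.inl k) fun h => hk (Sum.inl_injective h)).symm
          simp [hk]
          rfl
      · refine Eq.trans ?_ (initList_stk_of_ne (machine c inp tmp out) (ea a)
          (k := Sum.inr (i, b)) Sum.inr_ne_inl).symm
        cases b <;> rfl
    have e2 : Sum.elim (run (ea a).length c (Function.update (fun _ => []) tmp
        (ea a).reverse)) (fun _ => []) =
        (Turing.haltList (machine c inp tmp out) (eb (f a))).stk := by
      rw [h]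
      funext k
      rcases k with k | ⟨i, b⟩
      · by_cases hk : k = out
        · subst hk
          refine Eq.trans ?_ (haltList_stk_self (machine c inp tmp k) (eb (f a))).symm
          change Function.update (fun _ => []) k (eb (f a)) k = _
          rw [Function.update_self]
        · refine Eq.trans ?_ (haltList_stk_of_ne (machine c inp tmp out) (eb (f a))
            (k := Sum.inl k) fun h => hk (Sum.inl_injective h)).symm
          change Function.update (fun _ => []) out (eb (f a)) k = _
          rw [Function.update_of_ne hk]
          rfl
      · exact (haltList_stk_of_ne (machine c inp tmp out) (eb (f a)) (k := Sum.inr (i, b))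
          Sum.inr_ne_inl).symm
    rw [e1, e2] at h4
    refine ReachesWithin.mono h4 ?_
    simp
  refine ⟨⟨⟨machine c inp tmp out, Equiv.refl _, Equiv.refl _⟩,
    (Polynomial.X + 1) + c.cost + (Polynomial.X + 1), fun a => ?_⟩⟩
  have := main a (List.map (Equiv.refl Γ).invFun (ea a))
    (List.map (Equiv.refl Γ).invFun (eb (f a))) (List.map_id _) (List.map_id _)
  exact ⟨⟨this.choose, this.choose_spec.2⟩, this.choose_spec.1⟩

end LoopProg

/-! ### Building blocks for loop programs -/

namespace LoopProg

variable {K Γ : Type} [DecidableEq K]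

/-- Programs executed one after the other. -/
def block : List (LoopProg K Γ) → LoopProg K Γ
  | [] => skip
  | c :: l => seq c (block l)

/-- `d` nested loops around a program. -/
def nest : ℕ → LoopProg K Γ → LoopProg K Γ
  | 0, c => c
  | d + 1, c => loop (nest d c)

/-- Move all symbols of `a` to `b`; this reverses their order. -/
def move (a b : K) : LoopProg K Γ := loop (mv a b)

/-- Remove all symbols of `a`. -/
def clear (a : K) : LoopProg K Γ := loop (pop a)

variable (N : ℕ)

@[simp] theorem run_skip (S : K → List Γ) : run N skip S = S := rfl

@[simp] theorem run_push (k : K) (a : Γ) (S : K → List Γ) :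
    run N (push k a) S = Function.update S k (a :: S k) := rfl

@[simp] theorem run_pop (k : K) (S : K → List Γ) :
    run N (pop k) S = Function.update S k (S k).tail := rfl

@[simp] theorem run_block_nil (S : K → List Γ) : run N (block []) S = S := rfl

@[simp] theorem run_block_cons (c : LoopProg K Γ) (l : List (LoopProg K Γ)) (S : K → List Γ) :
    run N (block (c :: l)) S = run N (block l) (run N c S) := rfl

@[simp] theorem run_ite (k : K) (p : Option Γ → Bool) (c d : LoopProg K Γ) (S : K → List Γ) :
    run N (ite k p c d) S = if p (S k).head? then run N c S else run N d S := rfl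

theorem run_mv_of_nil {a b : K} {S : K → List Γ} (h : S a = []) : run N (mv a b) S = S := by
  simp [run, h]

theorem run_mv_of_cons {a b : K} (hab : a ≠ b) {S : K → List Γ} {x : Γ} {l : List Γ}
    (h : S a = x :: l) :
    run N (mv a b) S = Function.update (Function.update S a l) b (x :: S b) := by
  simp [run, h, hab.symm]

/-- For different stacks, `mv` acts on each stack by a function that is also correct for an empty
source. -/
theorem run_mv {a b : K} (hab : a ≠ b) (S : K → List Γ) :
    run N (mv a b) S =
      Function.update (Function.update S a (S a).tail) b ((S a).take 1 ++ S b) := by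
  cases h : S a with
  | nil =>
    have h1 : Function.update S a [] = S := by rw [← h, Function.update_eq_self]
    rw [run_mv_of_nil N h, List.tail_nil, h1, List.take_nil, List.nil_append,
      Function.update_eq_self]
  | cons x l => rw [run_mv_of_cons N hab h]; rfl

theorem run_loop (c : LoopProg K Γ) (S : K → List Γ) :
    run N (loop c) S = (run N c)^[N] S := rfl

theorem run_nest (d : ℕ) (c : LoopProg K Γ) : run N (nest d c) = (run N c)^[N ^ d] := by
  induction d with
  | zero => simp [nest]
  | succ d ih =>
    funext S
    rw [nest, run_loop, ih, ← Function.iterate_mul, pow_succ]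

theorem iterate_eq_of_fixed {α : Type*} {f : α → α} {x y : α} {a n : ℕ} (h : f^[a] x = y)
    (hy : f y = y) (han : a ≤ n) : f^[n] x = y := by
  obtain ⟨b, rfl⟩ := Nat.exists_eq_add_of_le' han
  rw [Function.iterate_add_apply, h, Function.iterate_fixed hy]

variable {N}

theorem run_move {a b : K} (hab : a ≠ b) {S : K → List Γ} (h : (S a).length ≤ N) :
    run N (move a b) S =
      Function.update (Function.update S a []) b ((S a).reverse ++ S b) := by
  refine iterate_eq_of_fixed (a := (S a).length) ?_ ?_ h
  · clear h
    induction hl : S a generalizing S with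
    | nil =>
      have h1 : Function.update S a [] = S := by rw [← hl, Function.update_eq_self]
      simp [h1]
    | cons x l ih =>
      have h2 := ih (S := run N (mv a b) S) (by rw [run_mv_of_cons N hab hl]; simp [hab])
      rw [List.length_cons, Function.iterate_succ_apply, h2, run_mv_of_cons N hab hl]
      rw [Function.update_self, Function.update_comm hab, Function.update_idem,
        Function.update_comm hab.symm, Function.update_idem]
      simp
  · exact run_mv_of_nil N (by simp [hab])

theorem iterate_pop (a : K) (S : K → List Γ) (n : ℕ) :
    (run N (pop a))^[n] S = Function.update S a ((S a).drop n) := by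
  induction n generalizing S with
  | zero => simp
  | succ n ih =>
    rw [Function.iterate_succ_apply, ih, run_pop, Function.update_idem, Function.update_self,
      ← List.drop_one, List.drop_drop, Nat.add_comm]

theorem run_clear {a : K} {S : K → List Γ} (h : (S a).length ≤ N) :
    run N (clear a) S = Function.update S a [] := by
  rw [clear, run_loop, iterate_pop, List.drop_eq_nil_of_le h]

theorem run_nest_pop {a : K} {S : K → List Γ} {d : ℕ} (h : (S a).length ≤ N ^ d) :
    run N (nest d (pop a)) S = Function.update S a [] := by
  rw [run_nest, iterate_pop, List.drop_eq_nil_of_le h]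

end LoopProg

/-! ### The program for local search -/

namespace LocalSearch

open LoopProg

/-- The stacks of the program; a primed stack is the partner of an unprimed one through which its
symbols are moved back and forth.
* `mat`: the rows of the approval matrix;
* `com`: the current committee;
* `new`: the committee after a swap;
* `src`, `dst`: the parties that lose and gain a seat, in unary and followed by the separator;
* `util`: the utility of a voter, in unary;
* `acc`: an accumulator for scores, in unary;
* `removed`, `inserted`, `better`: flags, which are set if the stack is nonempty. -/
inductive Reg
  | mat | mat' | com | com' | new | new' | src | src' | dst | dst' | util | util'
  | acc | removed | inserted | better
  deriving DecidableEq

instance : Fintype Reg where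
  elems := {.mat, .mat', .com, .com', .new, .new', .src, .src', .dst, .dst', .util, .util', .acc,
    .removed, .inserted, .better}
  complete := by intro k; cases k <;> decide

/-- The contents of the stacks. -/
structure Store where
  mat : List (Option Bool) := []
  mat' : List (Option Bool) := []
  com : List (Option Bool) := []
  com' : List (Option Bool) := []
  new : List (Option Bool) := []
  new' : List (Option Bool) := []
  src : List (Option Bool) := []
  src' : List (Option Bool) := []
  dst : List (Option Bool) := []
  dst' : List (Option Bool) := []
  util : List (Option Bool) := []
  util' : List (Option Bool) := []
  acc : List (Option Bool) := []
  removed : List (Option Bool) := []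
  inserted : List (Option Bool) := []
  better : List (Option Bool) := []

/-- The contents of the stacks as a function. -/
def Store.toFun (s : Store) : Reg → List (Option Bool)
  | .mat => s.mat | .mat' => s.mat' | .com => s.com | .com' => s.com' | .new => s.new
  | .new' => s.new' | .src => s.src | .src' => s.src' | .dst => s.dst | .dst' => s.dst'
  | .util => s.util | .util' => s.util' | .acc => s.acc | .removed => s.removed
  | .inserted => s.inserted | .better => s.better

namespace Store

variable (s : Store) (l : List (Option Bool))

@[simp] theorem toFun_mat : s.toFun .mat = s.mat := rfl

@[simp] theorem toFun_mat' : s.toFun .mat' = s.mat' := rfl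

@[simp] theorem toFun_com : s.toFun .com = s.com := rfl

@[simp] theorem toFun_com' : s.toFun .com' = s.com' := rfl

@[simp] theorem toFun_new : s.toFun .new = s.new := rfl

@[simp] theorem toFun_new' : s.toFun .new' = s.new' := rfl

@[simp] theorem toFun_src : s.toFun .src = s.src := rfl

@[simp] theorem toFun_src' : s.toFun .src' = s.src' := rfl

@[simp] theorem toFun_dst : s.toFun .dst = s.dst := rfl

@[simp] theorem toFun_dst' : s.toFun .dst' = s.dst' := rfl

@[simp] theorem toFun_util : s.toFun .util = s.util := rfl

@[simp] theorem toFun_util' : s.toFun .util' = s.util' := rfl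

@[simp] theorem toFun_acc : s.toFun .acc = s.acc := rfl

@[simp] theorem toFun_removed : s.toFun .removed = s.removed := rfl

@[simp] theorem toFun_inserted : s.toFun .inserted = s.inserted := rfl

@[simp] theorem toFun_better : s.toFun .better = s.better := rfl

@[simp] theorem update_mat :
    Function.update s.toFun .mat l = { s with mat := l }.toFun := by
  funext k; cases k <;> rfl

@[simp] theorem update_mat' :
    Function.update s.toFun .mat' l = { s with mat' := l }.toFun := by
  funext k; cases k <;> rfl

@[simp] theorem update_com :
    Function.update s.toFun .com l = { s with com := l }.toFun := by
  funext k; cases k <;> rfl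

@[simp] theorem update_com' :
    Function.update s.toFun .com' l = { s with com' := l }.toFun := by
  funext k; cases k <;> rfl

@[simp] theorem update_new :
    Function.update s.toFun .new l = { s with new := l }.toFun := by
  funext k; cases k <;> rfl

@[simp] theorem update_new' :
    Function.update s.toFun .new' l = { s with new' := l }.toFun := by
  funext k; cases k <;> rfl

@[simp] theorem update_src :
    Function.update s.toFun .src l = { s with src := l }.toFun := by
  funext k; cases k <;> rfl

@[simp] theorem update_src' :
    Function.update s.toFun .src' l = { s with src' := l }.toFun := by
  funext k; cases k <;> rfl

@[simp] theorem update_dst :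
    Function.update s.toFun .dst l = { s with dst := l }.toFun := by
  funext k; cases k <;> rfl

@[simp] theorem update_dst' :
    Function.update s.toFun .dst' l = { s with dst' := l }.toFun := by
  funext k; cases k <;> rfl

@[simp] theorem update_util :
    Function.update s.toFun .util l = { s with util := l }.toFun := by
  funext k; cases k <;> rfl

@[simp] theorem update_util' :
    Function.update s.toFun .util' l = { s with util' := l }.toFun := by
  funext k; cases k <;> rfl

@[simp] theorem update_acc :
    Function.update s.toFun .acc l = { s with acc := l }.toFun := by
  funext k; cases k <;> rfl

@[simp] theorem update_removed :
    Function.update s.toFun .removed l = { s with removed := l }.toFun := by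
  funext k; cases k <;> rfl

@[simp] theorem update_inserted :
    Function.update s.toFun .inserted l = { s with inserted := l }.toFun := by
  funext k; cases k <;> rfl

@[simp] theorem update_better :
    Function.update s.toFun .better l = { s with better := l }.toFun := by
  funext k; cases k <;> rfl

end Store

/-- The symbol for a seat, and for an approval. -/
abbrev one : Option Bool := some true

/-- The separator. -/
abbrev sep : Option Bool := none

/-- Loop programs over the stacks of the local search; the symbols are those of the encodings. -/
abbrev Prog : Type := LoopProg Reg (Option Bool)

/-- One symbol of the scan that writes to `new'` (in reverse order) the committee that results from
`com` if the party `src` loses a seat and the party `dst` gains one. -/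
def swapScan : Prog :=
  ite .com (· == some one)
    (block [push .new' one, mv .com .com'])
    (ite .com Option.isSome
      (block [
        ite .src (· == some sep)
          (ite .new' (· == some one) (block [pop .new', push .removed one]) skip) skip,
        ite .dst (· == some sep) (block [push .new' one, push .inserted one]) skip,
        mv .src .src', mv .dst .dst', push .new' sep, mv .com .com'])
      skip)

/-- Write to `new` the committee that results from `com` if the party `src` loses a seat and the
party `dst` gains one; the flags tell whether this was possible. -/
def buildSwap : Prog :=
  block [loop swapScan, move .com' .com, move .src' .src, move .dst' .dst, move .new' .new]

/-- One symbol of the scan that writes to `util` the utility that the voter whose row is on the top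
of `mat` has for `com`. -/
def utilScan : Prog :=
  ite .com (· == some one)
    (block [ite .mat (· == some one) (push .util one) skip, mv .com .com'])
    (ite .com Option.isSome (block [mv .mat .mat', mv .com .com']) skip)

/-- One unit of the division of `N ^ 4` by the number in `util`: a symbol moves from `util` to
`util'`, and whenever `util` has become empty, `em` is executed and `util` is restored. -/
def tick (em : Prog) : Prog :=
  block [mv .util .util', ite .util Option.isNone (block [em, move .util' .util]) skip]

/-- Execute `em` as often as the voter with utility `util` contributes to the score. -/
def harmonicSum (em : Prog) : Prog :=
  loop (ite .util Option.isSome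
    (block [nest 4 (tick em), move .util' .util, pop .util]) skip)

/-- Execute `em` as often as the voter whose row is on the top of `mat` contributes to the score,
and move this row to `mat'`. -/
def scoreRow (em : Prog) : Prog :=
  ite .mat Option.isSome
    (block [loop utilScan, mv .mat .mat', move .com' .com, harmonicSum em]) skip

/-- Execute `em` as often as the score of `com` says. -/
def score (em : Prog) : Prog :=
  block [loop (scoreRow em), move .mat' .mat]

/-- Add one to the accumulator. -/
def count : Prog := push .acc one

/-- Subtract one from the accumulator, and set the flag `better` if that is impossible. -/
def countdown : Prog :=
  ite .acc Option.isSome (pop .acc) (ite .better Option.isNone (push .better one) skip)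

/-- Exchange `com` and `new`. -/
def exchange : Prog :=
  block [move .com .com', move .new .new', move .new' .com, move .com' .new]

/-- Perform the swap from `src` to `dst` if it is possible and increases the score. -/
def trySwap : Prog :=
  block [buildSwap,
    ite .removed Option.isSome
      (ite .inserted Option.isSome
        (block [score count, exchange, score countdown, ite .better Option.isSome skip exchange,
          nest 6 (pop .acc), pop .better])
        skip)
      skip,
    clear .new, clear .removed, clear .inserted]

/-- Try all swaps with the party `src` as the one that loses a seat. -/
def sweepDst : Prog :=
  block [push .dst sep, loop (block [trySwap, push .dst one]), clear .dst, pop .dst]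

/-- Try all swaps. -/
def sweep : Prog :=
  block [push .src sep, loop (block [sweepDst, push .src one]), clear .src, pop .src]

/-- Read the input and write to `com` the committee that gives all seats to the first party. -/
def init : Prog :=
  block [move .mat' .mat, loop (ite .mat (· == some one) (mv .mat .com') skip), pop .mat,
    loop (ite .mat (· == some one) (block [pop .mat, push .com sep]) skip), pop .mat,
    move .com' .com]

/-- The program for local search. -/
def prog : Prog := block [init, nest 6 sweep, clear .mat]

/-! ### Encodings of committees and matrices -/

/-- The encoding of a committee by its list of seat numbers. -/
def enc (c : List ℕ) : List (Option Bool) := c.flatMap fun n => List.replicate n one ++ [sep]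

/-- The encoding of an approval matrix by its list of rows. -/
def encRows (rows : List (List Bool)) : List (Option Bool) :=
  rows.flatMap fun r => r.map some ++ [sep]

/-- The utility for a committee of a voter with the given row of the matrix. -/
def dot : List Bool → List ℕ → ℕ
  | b :: r, n :: c => (if b then n else 0) + dot r c
  | _, _ => 0

/-- An integer approximation of `M` times the harmonic number of `u`, where each summand is rounded
down. -/
def roundedHarmonic (M u : ℕ) : ℕ := ∑ t ∈ Finset.range u, M / (t + 1)

/-- The rounded score: an integer approximation of `M` times the PAV score of the committee `c`. -/
def roundedScore (M : ℕ) (rows : List (List Bool)) (c : List ℕ) : ℕ :=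
  (rows.map fun r => roundedHarmonic M (dot r c)).sum

/-- The committee that `swapScan` computes when `src` and `dst` have the contents `P` and `Q`. -/
def swapped : List (Option Bool) → List (Option Bool) → List ℕ → List ℕ
  | _, _, [] => []
  | P, Q, n :: c =>
    ((if P.head? = some sep then n - 1 else n) + if Q.head? = some sep then 1 else 0) ::
      swapped P.tail Q.tail c

/-- The contents of `removed` after `swapScan`. -/
def removedFlag : List (Option Bool) → List ℕ → List (Option Bool) → List (Option Bool)
  | _, [], R => R
  | P, n :: c, R =>
    removedFlag P.tail c (if P.head? = some sep ∧ 0 < n then one :: R else R)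

/-- The contents of `inserted` after `swapScan`. -/
def insertedFlag : List (Option Bool) → List ℕ → List (Option Bool) → List (Option Bool)
  | _, [], R => R
  | Q, _ :: c, R => insertedFlag Q.tail c (if Q.head? = some sep then one :: R else R)

theorem enc_cons (n : ℕ) (c : List ℕ) : enc (n :: c) = List.replicate n one ++ sep :: enc c := by
  simp [enc]

theorem enc_length (c : List ℕ) : (enc c).length = c.sum + c.length := by
  induction c with
  | nil => rfl
  | cons n c ih => rw [enc_cons]; simp [ih]; omega

variable {N : ℕ}

attribute [local simp] run_mv

theorem Store.run_move {a b : Reg} (hab : a ≠ b) {s : Store} (h : (s.toFun a).length ≤ N) :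
    run N (move a b) s.toFun =
      Function.update (Function.update s.toFun a []) b ((s.toFun a).reverse ++ s.toFun b) :=
  LoopProg.run_move hab h

theorem Store.run_clear {a : Reg} {s : Store} (h : (s.toFun a).length ≤ N) :
    run N (clear a) s.toFun = Function.update s.toFun a [] :=
  LoopProg.run_clear h

theorem iterate_swapScan_ones (n : ℕ) : ∀ (s : Store) (l : List (Option Bool)),
    s.com = List.replicate n one ++ l →
    (run N swapScan)^[n] s.toFun =
      { s with
        com := l, com' := List.replicate n one ++ s.com'
        new' := List.replicate n one ++ s.new' : Store }.toFun := by
  induction n with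
  | zero => intro s l h; simp at h; subst h; rfl
  | succ n ih =>
    intro s l h
    have h1 : run N swapScan s.toFun = { s with
        com := List.replicate n one ++ l, com' := one :: s.com'
        new' := one :: s.new' : Store }.toFun := by
      simp [swapScan, h, List.replicate_succ]
    rw [Function.iterate_succ_apply, h1, ih _ l rfl]
    simp [List.replicate_succ']

theorem run_swapScan_sep (s : Store) (n : ℕ) (l v : List (Option Bool)) (h : s.com = sep :: l)
    (hv : s.new' = List.replicate n one ++ v) (hv' : v.head? ≠ some one) :
    run N swapScan s.toFun =
      { s with
        com := l, com' := sep :: s.com', src := s.src.tail, src' := s.src.take 1 ++ s.src',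
        dst := s.dst.tail, dst' := s.dst.take 1 ++ s.dst',
        new' := sep :: (List.replicate ((if s.src.head? = some sep then n - 1 else n) +
          if s.dst.head? = some sep then 1 else 0) one ++ v)
        removed := if s.src.head? = some sep ∧ 0 < n then one :: s.removed else s.removed
        inserted := if s.dst.head? = some sep then one :: s.inserted else s.inserted
        : Store }.toFun := by
  by_cases hP : s.src.head? = some sep <;> by_cases hQ : s.dst.head? = some sep <;>
    rcases n with _ | n <;> simp [swapScan, h, hP, hQ, hv, hv', List.replicate_succ]

theorem iterate_swapScan (c : List ℕ) : ∀ s : Store, s.com = enc c → s.new'.head? ≠ some one →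
    (run N swapScan)^[(enc c).length] s.toFun =
      { s with
        com := [], com' := (enc c).reverse ++ s.com'
        src := s.src.drop c.length, src' := (s.src.take c.length).reverse ++ s.src'
        dst := s.dst.drop c.length, dst' := (s.dst.take c.length).reverse ++ s.dst'
        new' := (enc (swapped s.src s.dst c)).reverse ++ s.new'
        removed := removedFlag s.src c s.removed
        inserted := insertedFlag s.dst c s.inserted : Store }.toFun := by
  induction c with
  | nil =>
    intro s h _
    obtain ⟨⟩ := s
    obtain rfl : _ = [] := h
    simp [enc, swapped, removedFlag, insertedFlag]
  | cons n c ih =>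
    intro s h hv
    rw [enc_cons] at h
    have hl : (enc (n :: c)).length = (enc c).length + 1 + n := by
      rw [enc_cons]; simp; omega
    rw [hl, Function.iterate_add_apply, iterate_swapScan_ones n s _ h, Function.iterate_succ_apply,
      run_swapScan_sep _ n (enc c) s.new' rfl rfl hv, ih _ rfl (by simp)]
    have ht : ∀ P : List (Option Bool), List.take (c.length + 1) P =
        P.take 1 ++ P.tail.take c.length := by
      intro P; cases P <;> simp
    have ht' : ∀ P : List (Option Bool), (P.take 1).reverse = P.take 1 := by
      intro P; cases P <;> simp
    simp only [enc_cons, swapped, removedFlag, insertedFlag, List.length_cons, ht]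
    congr 1
    simp [ht']

theorem run_buildSwap (s : Store) (c : List ℕ) (hc : s.com = enc c) (hcom' : s.com' = [])
    (hnew : s.new = []) (hnew' : s.new' = []) (hsrc' : s.src' = []) (hdst' : s.dst' = [])
    (hN : (enc c).length ≤ N) (hsrc : s.src.length ≤ N) (hdst : s.dst.length ≤ N)
    (hN' : (enc (swapped s.src s.dst c)).length ≤ N) :
    run N buildSwap s.toFun =
      { s with
        new := enc (swapped s.src s.dst c)
        removed := removedFlag s.src c s.removed
        inserted := insertedFlag s.dst c s.inserted : Store }.toFun := by
  have h1 : run N (loop swapScan) s.toFun = _ := iterate_eq_of_fixed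
    (iterate_swapScan (N := N) c s hc (by simp [hnew'])) (by simp [swapScan]) hN
  simp only [buildSwap, run_block_cons, h1]
  rw [Store.run_move (by decide) (by simpa [hcom'] using hN)]
  simp
  rw [Store.run_move (by decide) (by simp [hsrc']; omega)]
  simp
  rw [Store.run_move (by decide) (by simp [hdst']; omega)]
  simp
  rw [Store.run_move (by decide) (by simpa [hnew'] using hN')]
  simp [hcom', hsrc', hdst', hnew', hnew, hc]

/-! ### The score -/

/-- The effect on `acc` and `better` of the program `em` that is executed for each unit of the
score. -/
def Store.emit (s : Store) (x : List (Option Bool) × List (Option Bool)) : Store :=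
  { s with acc := x.1, better := x.2 }

attribute [local simp] Store.emit

theorem iterate_utilScan_ones (n : ℕ) : ∀ (s : Store) (l : List (Option Bool)),
    s.com = List.replicate n one ++ l →
    (run N utilScan)^[n] s.toFun =
      { s with
        com := l, com' := List.replicate n one ++ s.com'
        util := List.replicate (if s.mat.head? = some one then n else 0) one ++ s.util
        : Store }.toFun := by
  induction n with
  | zero => intro s l h; simp at h; subst h; simp
  | succ n ih =>
    intro s l h
    have h1 : run N utilScan s.toFun = { s with
        com := List.replicate n one ++ l, com' := one :: s.com'
        util := if s.mat.head? = some one then one :: s.util else s.util : Store }.toFun := by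
      by_cases hm : s.mat.head? = some one <;> simp [utilScan, h, hm, List.replicate_succ]
    rw [Function.iterate_succ_apply, h1, ih _ l rfl]
    by_cases hm : s.mat.head? = some one <;> simp [hm, List.replicate_succ']

theorem iterate_utilScan (c : List ℕ) : ∀ (s : Store) (r : List Bool) (l : List (Option Bool)),
    s.com = enc c → s.mat = r.map some ++ l → r.length = c.length →
    (run N utilScan)^[(enc c).length] s.toFun =
      { s with
        com := [], com' := (enc c).reverse ++ s.com'
        mat := l, mat' := (r.map some).reverse ++ s.mat'
        util := List.replicate (dot r c) one ++ s.util : Store }.toFun := by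
  induction c with
  | nil =>
    intro s r l h hm hr
    obtain ⟨⟩ := s
    obtain rfl : _ = [] := h
    obtain rfl : r = [] := List.eq_nil_of_length_eq_zero hr
    obtain rfl : _ = l := hm
    simp [enc, dot]
  | cons n c ih =>
    intro s r l h hm hr
    obtain _ | ⟨b, r⟩ := r
    · simp at hr
    rw [enc_cons] at h
    have hl : (enc (n :: c)).length = (enc c).length + 1 + n := by
      rw [enc_cons]; simp; omega
    rw [hl, Function.iterate_add_apply, iterate_utilScan_ones n s _ h, Function.iterate_succ_apply]
    have h1 : ∀ t : Store, t.com = sep :: enc c → t.mat = s.mat → run N utilScan t.toFun =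
        { t with
          com := enc c, com' := sep :: t.com', mat := r.map some ++ l
          mat' := some b :: t.mat' : Store }.toFun := by
      intro t ht htm
      simp [utilScan, ht, htm, hm]
    have h2 : (if s.mat.head? = some one then n else 0) = if b then n else 0 := by simp [hm]
    rw [h1, ih _ r l rfl rfl (by simpa using hr)]
    · simp only [h2, dot, enc_cons, Nat.add_comm (if b then n else 0), List.replicate_add,
        List.append_assoc]
      congr 1
      simp [-List.replicate_append_replicate]
    · rfl
    · rfl

variable {em : Prog} {e : List (Option Bool) × List (Option Bool) →
  List (Option Bool) × List (Option Bool)}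

theorem run_tick_of_pos (s : Store) (v r : ℕ) (hs : s.util = List.replicate (v + 2) one)
    (hs' : s.util' = List.replicate r one) :
    run N (tick em) s.toFun =
      { s with util := List.replicate (v + 1) one, util' := List.replicate (r + 1) one }.toFun := by
  simp [tick, hs, hs', List.replicate_succ]

theorem run_tick_of_one
    (hem : ∀ s : Store, run N em s.toFun = (s.emit (e (s.acc, s.better))).toFun)
    (s : Store) (r : ℕ) (hr : r < N) (hs : s.util = [one]) (hs' : s.util' = List.replicate r one) :
    run N (tick em) s.toFun =
      ({ s with util := List.replicate (r + 1) one, util' := [] : Store }.emit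
        (e (s.acc, s.better))).toFun := by
  simp [tick, hs, hs', hem, Store.emit]
  rw [Store.run_move (by decide) (by simpa using hr)]
  simp [List.replicate_succ']

/-- The program `em` is executed `⌊M / u⌋` times in `M` ticks. -/
theorem iterate_tick (hem : ∀ s : Store, run N em s.toFun = (s.emit (e (s.acc, s.better))).toFun)
    (s : Store) (u : ℕ) (hu : 0 < u) (huN : u ≤ N) (hs : s.util = List.replicate u one)
    (hs' : s.util' = []) (M : ℕ) :
    (run N (tick em))^[M] s.toFun =
      ({ s with
        util := List.replicate (u - M % u) one
        util' := List.replicate (M % u) one : Store }.emit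
          (e^[M / u] (s.acc, s.better))).toFun := by
  induction M with
  | zero => simp [← hs, ← hs']
  | succ M ih =>
    rw [Function.iterate_succ_apply', ih]
    have hlt := Nat.mod_lt M hu
    have hdm := Nat.mod_add_div M u
    rcases Nat.lt_or_ge (M % u + 1) u with h | h
    · obtain ⟨h1, h2⟩ : (M + 1) / u = M / u ∧ (M + 1) % u = M % u + 1 :=
        (Nat.div_mod_unique hu).2 ⟨by omega, h⟩
      rw [run_tick_of_pos _ (u - M % u - 2) (M % u) (by
        rw [show u - M % u - 2 + 2 = u - M % u by omega]; rfl) rfl, h1, h2,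
        show u - M % u - 2 + 1 = u - (M % u + 1) by omega]
      rfl
    · obtain ⟨h1, h2⟩ : (M + 1) / u = M / u + 1 ∧ (M + 1) % u = 0 :=
        (Nat.div_mod_unique hu).2 ⟨by rw [Nat.mul_succ]; omega, hu⟩
      rw [run_tick_of_one hem _ (M % u) (by omega) (by
        rw [show u - M % u = 1 by omega]; rfl) rfl, h1, h2, show M % u + 1 = u by omega,
        Function.iterate_succ_apply']
      rfl

theorem run_harmonicSum
    (hem : ∀ s : Store, run N em s.toFun = (s.emit (e (s.acc, s.better))).toFun)
    (u : ℕ) (huN : u ≤ N) (s : Store) (hs : s.util = List.replicate u one) (hs' : s.util' = []) :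
    run N (harmonicSum em) s.toFun =
      ({ s with util := [] : Store }.emit
        (e^[roundedHarmonic (N ^ 4) u] (s.acc, s.better))).toFun := by
  refine iterate_eq_of_fixed (a := u) ?_ (by simp) huN
  induction u generalizing s with
  | zero =>
    obtain ⟨⟩ := s
    obtain rfl : _ = [] := hs
    simp [roundedHarmonic, Store.emit]
  | succ u ih =>
    have h1 : run N (ite Reg.util Option.isSome
        (block [nest 4 (tick em), move Reg.util' Reg.util, pop Reg.util]) skip) s.toFun =
        ({ s with util := List.replicate u one : Store }.emit
          (e^[N ^ 4 / (u + 1)] (s.acc, s.better))).toFun := by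
      have hlt : N ^ 4 % (u + 1) < u + 1 := Nat.mod_lt _ (Nat.succ_pos u)
      simp only [run_ite, Store.toFun_util, hs, List.replicate_succ, List.head?_cons,
        Option.isSome_some, if_true, run_block_cons, run_nest,
        iterate_tick hem s (u + 1) (Nat.succ_pos u) huN hs hs']
      rw [Store.run_move (by decide) (by simp; omega)]
      simp [hs']
      rw [show N ^ 4 % (u + 1) + (u + 1 - N ^ 4 % (u + 1)) - 1 = u by omega]
    rw [Function.iterate_succ_apply, h1, ih (by omega)]
    · rw [roundedHarmonic, roundedHarmonic, Finset.sum_range_succ, Function.iterate_add_apply]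
      rfl
    · rfl
    · exact hs'

theorem dot_le_sum (r : List Bool) (c : List ℕ) : dot r c ≤ c.sum := by
  induction c generalizing r with
  | nil => cases r <;> simp [dot]
  | cons n c ih =>
    cases r with
    | nil => simp [dot]
    | cons b r =>
      have := ih r
      simp only [dot, List.sum_cons]
      split_ifs <;> omega

theorem run_scoreRow
    (hem : ∀ s : Store, run N em s.toFun = (s.emit (e (s.acc, s.better))).toFun)
    (c : List ℕ) (hN : (enc c).length ≤ N) (r : List Bool) (hr : r.length = c.length)
    (l : List (Option Bool)) (s : Store) (hc : s.com = enc c) (hcom' : s.com' = [])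
    (hm : s.mat = r.map some ++ sep :: l) (hu : s.util = []) (hu' : s.util' = []) :
    run N (scoreRow em) s.toFun =
      ({ s with mat := l, mat' := (r.map some ++ [sep]).reverse ++ s.mat' : Store }.emit
        (e^[roundedHarmonic (N ^ 4) (dot r c)] (s.acc, s.better))).toFun := by
  have h1 : run N (loop utilScan) s.toFun = _ := iterate_eq_of_fixed
    (iterate_utilScan (N := N) c s r (sep :: l) hc hm hr) (by simp [utilScan]) hN
  have h2 : s.mat.head?.isSome = true := by
    rw [hm]; cases r <;> rfl
  have h3 := enc_length c
  have h4 := dot_le_sum r c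
  simp only [scoreRow, run_ite, Store.toFun_mat, h2, if_true, run_block_cons, h1]
  simp
  rw [Store.run_move (by decide) (by simpa [hcom'] using hN)]
  simp
  rw [run_harmonicSum hem (dot r c) (by omega)]
  · simp [hc, hcom', hu]
  · simp [hu]
  · exact hu'

theorem length_le_encRows_length (rows : List (List Bool)) :
    rows.length ≤ (encRows rows).length := by
  induction rows with
  | nil => simp
  | cons r rows ih => simp [encRows] at ih ⊢; omega

/-- The program `em` is executed as often as the rounded score says. -/
theorem run_score
    (hem : ∀ s : Store, run N em s.toFun = (s.emit (e (s.acc, s.better))).toFun)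
    (c : List ℕ) (hN : (enc c).length ≤ N) (rows : List (List Bool))
    (hr : ∀ r ∈ rows, r.length = c.length) (hrows : (encRows rows).length ≤ N)
    (s : Store) (hc : s.com = enc c) (hcom' : s.com' = [])
    (hm : s.mat = encRows rows) (hm' : s.mat' = []) (hu : s.util = []) (hu' : s.util' = []) :
    run N (score em) s.toFun =
      (s.emit (e^[roundedScore (N ^ 4) rows c] (s.acc, s.better))).toFun := by
  have hl := length_le_encRows_length rows
  have h1 : ∀ (rows : List (List Bool)) (s : Store), (∀ r ∈ rows, r.length = c.length) →
      s.com = enc c → s.com' = [] → s.mat = encRows rows → s.util = [] → s.util' = [] →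
      (run N (scoreRow em))^[rows.length] s.toFun =
        ({ s with mat := [], mat' := (encRows rows).reverse ++ s.mat' : Store }.emit
          (e^[roundedScore (N ^ 4) rows c] (s.acc, s.better))).toFun := by
    intro rows
    induction rows with
    | nil =>
      intro s _ _ _ hm _ _
      obtain ⟨⟩ := s
      obtain rfl : _ = [] := hm
      simp [encRows, roundedScore, Store.emit]
    | cons r rows ih =>
      intro s hr hc hcom' hm hu hu'
      rw [List.length_cons, Function.iterate_succ_apply,
        run_scoreRow hem c hN r (hr r List.mem_cons_self) (encRows rows) s hc hcom'
          (by rw [hm]; simp [encRows]) hu hu', ih _ (fun r h => hr r (List.mem_cons_of_mem _ h))]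
      all_goals first | assumption | rfl | skip
      simp [encRows, roundedScore, ← Function.iterate_add_apply, Nat.add_comm]
  have h2 : run N (loop (scoreRow em)) s.toFun = _ := iterate_eq_of_fixed
    (h1 rows s hr hc hcom' hm hu hu') (by simp [scoreRow]) (hl.trans hrows)
  simp only [score, run_block_cons, h2]
  rw [Store.run_move (by decide) (by simpa [hm'] using hrows)]
  simp [hm, hm']

/-! ### One swap -/

theorem roundedHarmonic_le (M u : ℕ) : roundedHarmonic M u ≤ u * M :=
  (Finset.sum_le_card_nsmul _ _ M fun t _ => Nat.div_le_self M (t + 1)).trans (by simp)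

theorem roundedScore_le (M : ℕ) (rows : List (List Bool)) (c : List ℕ) :
    roundedScore M rows c ≤ rows.length * (c.sum * M) := by
  induction rows with
  | nil => simp [roundedScore]
  | cons r rows ih =>
    have h1 := roundedHarmonic_le M (dot r c)
    have h2 := Nat.mul_le_mul_right M (dot_le_sum r c)
    simp only [roundedScore, List.map_cons, List.sum_cons, List.length_cons, Nat.add_mul,
      Nat.one_mul] at ih ⊢
    omega

/-- The unary encoding of the index of a party in `src` and `dst`. -/
def unary (p : ℕ) : List (Option Bool) := List.replicate p one ++ [sep]

theorem unary_zero : unary 0 = [sep] := rfl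

theorem unary_succ (p : ℕ) : unary (p + 1) = one :: unary p := rfl

theorem unary_length (p : ℕ) : (unary p).length = p + 1 := by simp [unary]

theorem removedFlag_nil (c : List ℕ) (R : List (Option Bool)) : removedFlag [] c R = R := by
  induction c with
  | nil => rfl
  | cons n c ih => simpa [removedFlag] using ih

theorem insertedFlag_nil (c : List ℕ) (R : List (Option Bool)) : insertedFlag [] c R = R := by
  induction c with
  | nil => rfl
  | cons n c ih => simpa [insertedFlag] using ih

theorem removedFlag_unary (p : ℕ) (c : List ℕ) (R : List (Option Bool)) :
    removedFlag (unary p) c R = if 0 < c.getD p 0 then one :: R else R := by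
  induction c generalizing p with
  | nil => simp [removedFlag]
  | cons n c ih =>
    cases p with
    | zero => simp [removedFlag, unary_zero, removedFlag_nil]
    | succ p => simpa [removedFlag, unary_succ] using ih p

theorem insertedFlag_unary (q : ℕ) (c : List ℕ) (R : List (Option Bool)) :
    insertedFlag (unary q) c R = if q < c.length then one :: R else R := by
  induction c generalizing q with
  | nil => simp [insertedFlag]
  | cons n c ih =>
    cases q with
    | zero => simp [insertedFlag, unary_zero, insertedFlag_nil]
    | succ q => simpa [insertedFlag, unary_succ] using ih q

theorem swapped_length (P Q : List (Option Bool)) (c : List ℕ) :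
    (swapped P Q c).length = c.length := by
  induction c generalizing P Q with
  | nil => rfl
  | cons n c ih => simp [swapped, ih]

theorem swapped_nil_nil (c : List ℕ) : swapped [] [] c = c := by
  induction c with
  | nil => rfl
  | cons n c ih => simpa [swapped] using ih

theorem swapped_nil_sum (P : List (Option Bool)) (c : List ℕ) : (swapped P [] c).sum ≤ c.sum := by
  induction c generalizing P with
  | nil => simp [swapped]
  | cons n c ih =>
    have := ih P.tail
    simp [swapped]
    split_ifs <;> omega

theorem swapped_unary_sum_le (P : List (Option Bool)) (q : ℕ) (c : List ℕ) :
    (swapped P (unary q) c).sum ≤ c.sum + 1 := by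
  induction c generalizing P q with
  | nil => simp [swapped]
  | cons n c ih =>
    cases q with
    | zero =>
      have := swapped_nil_sum P.tail c
      simp [swapped, unary_zero]
      split_ifs <;> omega
    | succ q =>
      have := ih P.tail q
      simp [swapped, unary_succ]
      split_ifs <;> omega

theorem swapped_nil_unary_sum (q : ℕ) (c : List ℕ) (h : q < c.length) :
    (swapped [] (unary q) c).sum = c.sum + 1 := by
  induction c generalizing q with
  | nil => simp at h
  | cons n c ih =>
    cases q with
    | zero =>
      simp only [swapped, unary_zero, List.head?_cons, List.tail_cons, List.sum_cons,
        List.head?_nil, List.tail_nil, swapped_nil_nil]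
      simp
      omega
    | succ q =>
      have := ih q (by simpa using h)
      simp only [swapped, unary_succ, List.head?_cons, List.tail_cons, List.sum_cons,
        List.head?_nil, List.tail_nil]
      simp
      omega

theorem swapped_unary_nil_sum (p : ℕ) (c : List ℕ) (h : 0 < c.getD p 0) :
    (swapped (unary p) [] c).sum + 1 = c.sum := by
  induction c generalizing p with
  | nil => simp at h
  | cons n c ih =>
    cases p with
    | zero =>
      simp only [swapped, unary_zero, List.head?_cons, List.tail_cons, List.sum_cons,
        List.head?_nil, List.tail_nil, swapped_nil_nil]
      simp at h ⊢
      omega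
    | succ p =>
      have := ih p (by simpa using h)
      simp only [swapped, unary_succ, List.head?_cons, List.tail_cons, List.sum_cons,
        List.head?_nil, List.tail_nil]
      simp
      omega

theorem swapped_sum (p q : ℕ) (c : List ℕ) (hp : 0 < c.getD p 0) (hq : q < c.length) :
    (swapped (unary p) (unary q) c).sum = c.sum := by
  induction c generalizing p q with
  | nil => simp at hq
  | cons n c ih =>
    rcases p with _ | p <;> rcases q with _ | q <;>
      simp only [swapped, unary_zero, unary_succ, List.head?_cons, List.tail_cons, List.sum_cons,
        swapped_nil_nil]
    · simp at hp ⊢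
      omega
    · have := swapped_nil_unary_sum q c (by simpa using hq)
      simp at hp ⊢
      omega
    · have := swapped_unary_nil_sum p c (by simpa using hp)
      simp
      omega
    · have := ih p q (by simpa using hp) (by simpa using hq)
      simpa using this

/-- The contents of `acc` and `better` after `count`. -/
def countEff (x : List (Option Bool) × List (Option Bool)) :
    List (Option Bool) × List (Option Bool) := (one :: x.1, x.2)

/-- The contents of `acc` and `better` after `countdown`. -/
def countdownEff (x : List (Option Bool) × List (Option Bool)) :
    List (Option Bool) × List (Option Bool) :=
  if x.1 = [] then (x.1, if x.2 = [] then [one] else x.2) else (x.1.tail, x.2)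

theorem run_count (s : Store) :
    run N count s.toFun = (s.emit (countEff (s.acc, s.better))).toFun := by
  simp [count, countEff]

theorem run_countdown (s : Store) :
    run N countdown s.toFun = (s.emit (countdownEff (s.acc, s.better))).toFun := by
  obtain ⟨⟩ := s
  simp only [countdown, countdownEff, Store.emit, run_ite, run_push, run_pop, Store.toFun_acc,
    Store.toFun_better]
  split_ifs <;> simp_all
  split_ifs <;> rfl

theorem iterate_countEff (j : ℕ) : countEff^[j] ([], []) = (List.replicate j one, []) := by
  induction j with
  | zero => rfl
  | succ j ih => rw [Function.iterate_succ_apply', ih]; rfl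

theorem iterate_countdownEff (a j : ℕ) : countdownEff^[j] (List.replicate a one, []) =
    (List.replicate (a - j) one, if a < j then [one] else []) := by
  induction j with
  | zero => simp
  | succ j ih =>
    rw [Function.iterate_succ_apply', ih]
    rcases Nat.lt_trichotomy a j with h | rfl | h
    · simp [countdownEff, h, show a < j + 1 by omega, show a - j = 0 by omega,
        show a - (j + 1) = 0 by omega]
    · simp [countdownEff]
    · obtain ⟨b, hb⟩ : ∃ b, a - j = b + 1 := ⟨a - j - 1, by omega⟩
      simp [countdownEff, hb, show ¬ a < j by omega, show ¬ a < j + 1 by omega,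
        show a - (j + 1) = b by omega]

theorem run_exchange (s : Store) (hcom' : s.com' = []) (hnew' : s.new' = [])
    (hc : s.com.length ≤ N) (hn : s.new.length ≤ N) :
    run N exchange s.toFun = { s with com := s.new, new := s.com }.toFun := by
  obtain ⟨⟩ := s
  simp only at hcom' hnew' hc hn
  subst hcom' hnew'
  simp only [exchange, run_block_cons, run_block_nil]
  rw [Store.run_move (by decide) (by simpa using hc)]
  simp
  rw [Store.run_move (by decide) (by simpa using hn)]
  simp
  rw [Store.run_move (by decide) (by simpa using hn)]
  simp
  rw [Store.run_move (by decide) (by simpa using hc)]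
  simp

/-- The stacks between the swaps, when the committee is `c` and the parties of the current swap are
given by `P` and `Q`. -/
def base (rows : List (List Bool)) (c : List ℕ) (P Q : List (Option Bool)) : Store :=
  { mat := encRows rows, com := enc c, src := P, dst := Q }

/-- The committee after the attempt to swap from `p` to `q`. -/
def trySwapped (M : ℕ) (rows : List (List Bool)) (p q : ℕ) (c : List ℕ) : List ℕ :=
  if 0 < c.getD p 0 ∧ q < c.length ∧
    roundedScore M rows c < roundedScore M rows (swapped (unary p) (unary q) c)
  then swapped (unary p) (unary q) c else c

/-- The sizes of an election with approval matrix `rows`, `m` parties and `k` seats, as far as they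
matter for loops with `N` repetitions. -/
structure Fits (N : ℕ) (rows : List (List Bool)) (m k : ℕ) : Prop where
  rows_length : ∀ r ∈ rows, r.length = m
  encRows_length : (encRows rows).length ≤ N
  size : k + m + 1 ≤ N

theorem Fits.score_le {rows : List (List Bool)} {m k : ℕ} (h : Fits N rows m k) (c : List ℕ)
    (hs : c.sum = k) : roundedScore (N ^ 4) rows c ≤ N ^ 6 := by
  have h1 := (length_le_encRows_length rows).trans h.encRows_length
  have h2 : c.sum ≤ N := by have := h.size; omega
  calc _ ≤ rows.length * (c.sum * N ^ 4) := roundedScore_le _ _ _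
    _ ≤ N * (N * N ^ 4) := by gcongr
    _ = N ^ 6 := by ring

/-- The flag `better` is set exactly if the score of the new committee, counted down from the old
one, exceeds it. -/
theorem run_trySwap {rows : List (List Bool)} {m k : ℕ} (h : Fits N rows m k) (c : List ℕ)
    (hl : c.length = m) (hs : c.sum = k) (p q : ℕ) (hp : p < N) (hq : q < N) :
    run N trySwap (base rows c (unary p) (unary q)).toFun =
      (base rows (trySwapped (N ^ 4) rows p q c) (unary p) (unary q)).toFun := by
  have hsize := h.size
  have hN : (enc c).length ≤ N := by rw [enc_length]; omega
  have hN' : (enc (swapped (unary p) (unary q) c)).length ≤ N := by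
    have := swapped_unary_sum_le (unary p) q c
    rw [enc_length, swapped_length]; omega
  set d := swapped (unary p) (unary q) c with hd
  have h1 : run N buildSwap (base rows c (unary p) (unary q)).toFun =
      { base rows c (unary p) (unary q) with
        new := enc d
        removed := if 0 < c.getD p 0 then [one] else []
        inserted := if q < c.length then [one] else [] : Store }.toFun := by
    rw [run_buildSwap (base rows c (unary p) (unary q)) c rfl rfl rfl rfl rfl rfl hN
      (by simpa [base, unary_length] using hp) (by simpa [base, unary_length] using hq) hN']
    simp only [base, removedFlag_unary, insertedFlag_unary, hd]
  have hclear : ∀ (c' d : List ℕ) (R I : List (Option Bool)), (enc d).length ≤ N →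
      R.length ≤ N → I.length ≤ N →
      run N (clear Reg.inserted) (run N (clear Reg.removed) (run N (clear Reg.new)
        ({ base rows c' (unary p) (unary q) with new := enc d, removed := R, inserted := I } :
          Store).toFun)) = (base rows c' (unary p) (unary q)).toFun := by
    intro c' d R I h1 h2 h3
    rw [Store.run_clear h1, Store.update_new, Store.run_clear h2, Store.update_removed,
      Store.run_clear h3, Store.update_inserted]
    rfl
  have hN1 : 1 ≤ N := by omega
  have hR : ∀ P : Prop, ∀ _ : Decidable P, (if P then [one] else []).length ≤ N := by
    intro P _
    split_ifs
    · exact hN1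
    · exact Nat.zero_le _
  have hr := h.rows_length
  rw [← hl] at hr
  have hr' : ∀ r ∈ rows, r.length = d.length := by rwa [hd, swapped_length]
  have hscore := h.score_le c hs
  have h2 : run N (block [score count, exchange, score countdown,
        ite .better Option.isSome skip exchange, nest 6 (pop .acc), pop .better])
      ({ base rows c (unary p) (unary q) with
        new := enc d, removed := [one], inserted := [one] : Store }).toFun =
      if roundedScore (N ^ 4) rows c < roundedScore (N ^ 4) rows d then
        ({ base rows d (unary p) (unary q) with
          new := enc c, removed := [one], inserted := [one] : Store }).toFun
      else ({ base rows c (unary p) (unary q) with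
          new := enc d, removed := [one], inserted := [one] : Store }).toFun := by
    simp only [run_block_cons, run_block_nil]
    rw [run_score run_count c hN rows hr h.encRows_length _ rfl rfl rfl rfl rfl rfl]
    simp only [base, Store.emit, iterate_countEff]
    rw [run_exchange _ rfl rfl hN hN',
      run_score run_countdown d hN' rows hr' h.encRows_length _ rfl rfl rfl rfl rfl rfl]
    simp only [Store.emit, iterate_countdownEff]
    have hacc : ∀ t : Store, t.acc = List.replicate
        (roundedScore (N ^ 4) rows c - roundedScore (N ^ 4) rows d) one →
        run N (nest 6 (pop Reg.acc)) t.toFun = { t with acc := [] }.toFun := by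
      intro t ht
      rw [run_nest_pop, Store.update_acc]
      rw [Store.toFun_acc, ht, List.length_replicate]
      omega
    split_ifs with hb
    · simp only [run_ite, Store.toFun_better, List.head?_cons, Option.isSome_some, if_true,
        run_skip]
      rw [hacc _ rfl]
      simp
    · simp only [run_ite, Store.toFun_better, List.head?_nil, Option.isSome_none,
        Bool.false_eq_true, if_false]
      rw [run_exchange _ rfl rfl hN' hN, hacc _ rfl]
      simp
  have h3 : ∀ S, run N trySwap S = run N (clear .inserted) (run N (clear .removed)
      (run N (clear .new) (run N (ite .removed Option.isSome (ite .inserted Option.isSome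
        (block [score count, exchange, score countdown,
          ite .better Option.isSome skip exchange, nest 6 (pop .acc), pop .better]) skip) skip)
        (run N buildSwap S)))) := fun _ => rfl
  rw [h3, h1]
  by_cases hp' : 0 < c.getD p 0
  · by_cases hq' : q < c.length
    · simp only [run_ite, Store.toFun_removed, Store.toFun_inserted, hp', hq', if_true,
        List.head?_cons, Option.isSome_some]
      rw [h2, trySwapped]
      by_cases hb : roundedScore (N ^ 4) rows c < roundedScore (N ^ 4) rows d
      · rw [if_pos hb, if_pos ⟨hp', hq', hb⟩, hclear d c [one] [one] hN hN1 hN1]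
      · rw [if_neg hb, if_neg (by tauto), hclear c d [one] [one] hN' hN1 hN1]
    · simp only [run_ite, Store.toFun_removed, Store.toFun_inserted, hp', hq', if_true, if_false,
        List.head?_cons, Option.isSome_some, List.head?_nil, Option.isSome_none,
        Bool.false_eq_true, run_skip]
      rw [hclear c d [one] [] hN' hN1 (Nat.zero_le _), trySwapped, if_neg (by tauto)]
  · simp only [run_ite, Store.toFun_removed, hp', if_false,
      List.head?_nil, Option.isSome_none, Bool.false_eq_true, run_skip]
    rw [hclear c d [] _ hN' (Nat.zero_le _) (hR _ _), trySwapped, if_neg (by tauto)]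

/-! ### Sweeps over all swaps -/

theorem trySwapped_length (M : ℕ) (rows : List (List Bool)) (p q : ℕ) (c : List ℕ) :
    (trySwapped M rows p q c).length = c.length := by
  rw [trySwapped]
  split_ifs
  · exact swapped_length _ _ _
  · rfl

theorem trySwapped_sum (M : ℕ) (rows : List (List Bool)) (p q : ℕ) (c : List ℕ) :
    (trySwapped M rows p q c).sum = c.sum := by
  rw [trySwapped]
  split_ifs with h
  · exact swapped_sum p q c h.1 h.2.1
  · rfl

/-- The committee after the attempts to swap from `p` to each of `0, …, n - 1`. -/
def sweptDst (M : ℕ) (rows : List (List Bool)) (p n : ℕ) (c : List ℕ) : List ℕ :=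
  (List.range n).foldl (fun c q => trySwapped M rows p q c) c

/-- The committee after the attempts to swap from each of `0, …, n - 1` to each of
`0, …, l - 1`. -/
def swept (M : ℕ) (rows : List (List Bool)) (l n : ℕ) (c : List ℕ) : List ℕ :=
  (List.range n).foldl (fun c p => sweptDst M rows p l c) c

theorem sweptDst_succ (M : ℕ) (rows : List (List Bool)) (p n : ℕ) (c : List ℕ) :
    sweptDst M rows p (n + 1) c = trySwapped M rows p n (sweptDst M rows p n c) := by
  simp [sweptDst, List.range_succ]

theorem swept_succ (M : ℕ) (rows : List (List Bool)) (l n : ℕ) (c : List ℕ) :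
    swept M rows l (n + 1) c = sweptDst M rows n l (swept M rows l n c) := by
  simp [swept, List.range_succ]

theorem sweptDst_length (M : ℕ) (rows : List (List Bool)) (p n : ℕ) (c : List ℕ) :
    (sweptDst M rows p n c).length = c.length := by
  induction n with
  | zero => rfl
  | succ n ih => rw [sweptDst_succ, trySwapped_length, ih]

theorem sweptDst_sum (M : ℕ) (rows : List (List Bool)) (p n : ℕ) (c : List ℕ) :
    (sweptDst M rows p n c).sum = c.sum := by
  induction n with
  | zero => rfl
  | succ n ih => rw [sweptDst_succ, trySwapped_sum, ih]

theorem swept_length (M : ℕ) (rows : List (List Bool)) (l n : ℕ) (c : List ℕ) :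
    (swept M rows l n c).length = c.length := by
  induction n with
  | zero => rfl
  | succ n ih => rw [swept_succ, sweptDst_length, ih]

theorem swept_sum (M : ℕ) (rows : List (List Bool)) (l n : ℕ) (c : List ℕ) :
    (swept M rows l n c).sum = c.sum := by
  induction n with
  | zero => rfl
  | succ n ih => rw [swept_succ, sweptDst_sum, ih]

theorem run_clear_pop {a : Reg} {s : Store} (h : (s.toFun a).length ≤ N + 1) :
    run N (pop a) (run N (clear a) s.toFun) = Function.update s.toFun a [] := by
  rw [clear, run_loop, ← Function.iterate_succ_apply' (run N (pop a)), iterate_pop,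
    List.drop_eq_nil_of_le h]

variable {rows : List (List Bool)} {m k : ℕ}

theorem run_sweepDst (h : Fits N rows m k) (c : List ℕ) (hl : c.length = m) (hs : c.sum = k)
    (p : ℕ) (hp : p < N) :
    run N sweepDst (base rows c (unary p) []).toFun =
      (base rows (sweptDst (N ^ 4) rows p N c) (unary p) []).toFun := by
  have h1 : ∀ j ≤ N, (run N (block [trySwap, push .dst one]))^[j]
      (base rows c (unary p) (unary 0)).toFun =
      (base rows (sweptDst (N ^ 4) rows p j c) (unary p) (unary j)).toFun := by
    intro j hj
    induction j with
    | zero => rfl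
    | succ j ih =>
      rw [Function.iterate_succ_apply', ih (by omega), run_block_cons,
        run_trySwap h _ (by rw [sweptDst_length, hl]) (by rw [sweptDst_sum, hs]) p j hp hj,
        sweptDst_succ]
      simp [base, unary_succ]
  have h2 : run N (push .dst sep) (base rows c (unary p) []).toFun =
      (base rows c (unary p) (unary 0)).toFun := by simp [base, unary_zero]
  simp only [sweepDst, run_block_cons, run_block_nil, h2, run_loop]
  rw [h1 N le_rfl, run_clear_pop]
  · simp [base]
  · simp [base, unary_length]

theorem run_sweep (h : Fits N rows m k) (c : List ℕ) (hl : c.length = m) (hs : c.sum = k) :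
    run N sweep (base rows c [] []).toFun =
      (base rows (swept (N ^ 4) rows N N c) [] []).toFun := by
  have h1 : ∀ j ≤ N, (run N (block [sweepDst, push .src one]))^[j]
      (base rows c (unary 0) []).toFun =
      (base rows (swept (N ^ 4) rows N j c) (unary j) []).toFun := by
    intro j hj
    induction j with
    | zero => rfl
    | succ j ih =>
      rw [Function.iterate_succ_apply', ih (by omega), run_block_cons,
        run_sweepDst h _ (by rw [swept_length, hl]) (by rw [swept_sum, hs]) j hj, swept_succ]
      simp [base, unary_succ]
  have h2 : run N (push .src sep) (base rows c [] []).toFun =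
      (base rows c (unary 0) []).toFun := by simp [base, unary_zero]
  simp only [sweep, run_block_cons, run_block_nil, h2, run_loop]
  rw [h1 N le_rfl, run_clear_pop]
  · simp [base]
  · simp [base, unary_length]

theorem iterate_sweep (h : Fits N rows m k) (c : List ℕ) (hl : c.length = m) (hs : c.sum = k)
    (j : ℕ) :
    (run N sweep)^[j] (base rows c [] []).toFun =
      (base rows ((swept (N ^ 4) rows N N)^[j] c) [] []).toFun := by
  induction j generalizing c with
  | zero => rfl
  | succ j ih =>
    rw [Function.iterate_succ_apply, run_sweep h c hl hs, ih _ (by rw [swept_length, hl])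
      (by rw [swept_sum, hs]), Function.iterate_succ_apply]

/-! ### The whole program -/

theorem run_init (hm : 0 < m) (l : List (Option Bool))
    (hl : l = List.replicate k one ++ sep :: (List.replicate m one ++ sep :: encRows rows))
    (hN : l.length = N) :
    run N init ({ mat' := l.reverse } : Store).toFun =
      (base rows (k :: List.replicate (m - 1) 0) [] []).toFun := by
  have hlen : k + m + 2 ≤ N := by rw [← hN, hl]; simp; omega
  have hrep : ∀ (j : ℕ) (a : Option Bool) (v : List (Option Bool)),
      List.replicate j a ++ a :: v = a :: (List.replicate j a ++ v) := by
    intro j a v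
    rw [← List.cons_append, ← List.replicate_succ, List.replicate_succ', List.append_assoc]
    rfl
  have h1 : ∀ (j : ℕ) (r v : List (Option Bool)),
      (run N (ite .mat (· == some one) (mv .mat .com') skip))^[j]
        ({ mat := List.replicate j one ++ sep :: r, com' := v } : Store).toFun =
        ({ mat := sep :: r, com' := List.replicate j one ++ v } : Store).toFun := by
    intro j
    induction j with
    | zero => intro r v; rfl
    | succ j ih =>
      intro r v
      rw [Function.iterate_succ_apply]
      have := ih r (one :: v)
      simp [List.replicate_succ] at this ⊢
      rw [this]
      congr 1
      rw [hrep]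
  have h2 : ∀ (j : ℕ) (r v w : List (Option Bool)),
      (run N (ite .mat (· == some one) (block [pop .mat, push .com sep]) skip))^[j]
        ({ mat := List.replicate j one ++ sep :: r, com := v, com' := w } : Store).toFun =
        ({ mat := sep :: r, com := List.replicate j sep ++ v, com' := w } : Store).toFun := by
    intro j
    induction j with
    | zero => intro r v w; rfl
    | succ j ih =>
      intro r v w
      rw [Function.iterate_succ_apply]
      have := ih r (sep :: v) w
      simp [List.replicate_succ] at this ⊢
      rw [this]
      congr 1
      rw [hrep]
  have e1 : run N (loop (ite .mat (· == some one) (mv .mat .com') skip))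
      ({ mat := l } : Store).toFun = _ :=
    iterate_eq_of_fixed (hl ▸ h1 k (List.replicate m one ++ sep :: encRows rows) [])
      (by simp) (by omega)
  have e2 : run N (loop (ite .mat (· == some one) (block [pop .mat, push .com sep]) skip))
      ({ mat := List.replicate m one ++ sep :: encRows rows,
         com' := List.replicate k one ++ [] } : Store).toFun = _ :=
    iterate_eq_of_fixed (h2 m (encRows rows) [] (List.replicate k one ++ []))
      (by simp) (by omega)
  simp only [init, run_block_cons, run_block_nil]
  rw [Store.run_move (by decide) (by simp [hN])]
  simp only [Store.toFun_mat', Store.toFun_mat, Store.update_mat', Store.update_mat,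
    List.reverse_reverse, List.append_nil]
  rw [e1]
  simp only [run_pop, Store.toFun_mat, Store.update_mat, List.tail_cons]
  rw [e2]
  simp only [Store.toFun_mat, Store.update_mat, List.tail_cons]
  rw [Store.run_move (by decide) (by simp; omega)]
  obtain ⟨m, rfl⟩ : ∃ j, m = j + 1 := ⟨m - 1, by omega⟩
  have e3 : ∀ j, enc (List.replicate j 0) = List.replicate j sep := by
    intro j
    induction j with
    | zero => rfl
    | succ j ih => rw [List.replicate_succ, enc_cons, ih]; rfl
  simp [base, enc_cons, e3, List.replicate_succ]

/-- The program computes the result of `N ^ 6` sweeps from the committee that gives all seats to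
the first party. -/
theorem run_prog (hm : 0 < m) (hr : ∀ r ∈ rows, r.length = m) (l : List (Option Bool))
    (hl : l = List.replicate k one ++ sep :: (List.replicate m one ++ sep :: encRows rows))
    (hN : l.length = N) :
    run N prog (Function.update (fun _ => []) .mat' l.reverse) =
      Function.update (fun _ => []) .com
        (enc ((swept (N ^ 4) rows N N)^[N ^ 6] (k :: List.replicate (m - 1) 0))) := by
  have hlen : (encRows rows).length + k + m + 2 = N := by rw [← hN, hl]; simp; omega
  have h : Fits N rows m k := ⟨hr, by omega, by omega⟩
  have e : (fun _ => [] : Reg → List (Option Bool)) = ({} : Store).toFun := by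
    funext x; cases x <;> rfl
  rw [e, Store.update_mat']
  simp only [prog, run_block_cons, run_block_nil, run_init hm l hl hN, run_nest]
  rw [iterate_sweep h _ (by simp; omega) (by simp), Store.run_clear h.encRows_length]
  simp [base]

/-! ### Stability after sufficiently many sweeps -/

/-- Potential argument for a sequence of attempts: if an attempt changes the state, it increases
the potential, so that a sequence of attempts either increases the potential or consists of
unsuccessful attempts at the initial state. -/
theorem foldl_eq_or_lt {S ι : Type} (f : S → ι → S) (φ : S → ℕ)
    (hf : ∀ s i, f s i = s ∨ φ s < φ (f s i)) (l : List ι) (s : S) :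
    (l.foldl f s = s ∧ ∀ i ∈ l, f s i = s) ∨ φ s < φ (l.foldl f s) := by
  induction l generalizing s with
  | nil => simp
  | cons i l ih =>
    rw [List.foldl_cons]
    rcases hf s i with h | h
    · rw [h]
      rcases ih s with ⟨h1, h2⟩ | h1
      · exact .inl ⟨h1, by simpa [h] using h2⟩
      · exact .inr h1
    · rcases ih (f s i) with ⟨h1, _⟩ | h1
      · rw [h1]; exact .inr h
      · exact .inr (h.trans h1)

theorem trySwapped_eq_or_lt (M : ℕ) (rows : List (List Bool)) (p q : ℕ) (c : List ℕ) :
    trySwapped M rows p q c = c ∨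
      roundedScore M rows c < roundedScore M rows (trySwapped M rows p q c) := by
  by_cases h : 0 < c.getD p 0 ∧ q < c.length ∧
    roundedScore M rows c < roundedScore M rows (swapped (unary p) (unary q) c)
  · rw [trySwapped, if_pos h]; exact .inr h.2.2
  · rw [trySwapped, if_neg h]; exact .inl rfl

theorem swept_eq_or_lt (M : ℕ) (rows : List (List Bool)) (l n : ℕ) (c : List ℕ) :
    (swept M rows l n c = c ∧ ∀ p < n, ∀ q < l, trySwapped M rows p q c = c) ∨
      roundedScore M rows c < roundedScore M rows (swept M rows l n c) := by
  have h1 := fun (c : List ℕ) (p : ℕ) => foldl_eq_or_lt (fun c q => trySwapped M rows p q c)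
    (roundedScore M rows) (fun c q => trySwapped_eq_or_lt M rows p q c) (List.range l) c
  rcases foldl_eq_or_lt (fun c p => sweptDst M rows p l c) (roundedScore M rows)
    (fun c p => (h1 c p).imp_left And.left) (List.range n) c with ⟨h2, h3⟩ | h2
  · refine .inl ⟨h2, fun p hp q hq => ?_⟩
    have h4 : sweptDst M rows p l c = c := h3 p (List.mem_range.mpr hp)
    rcases h1 c p with ⟨_, h5⟩ | h5
    · exact h5 q (List.mem_range.mpr hq)
    · exact absurd (congrArg (roundedScore M rows) h4) h5.ne'
  · exact .inr h2

theorem iterate_swept_length (M : ℕ) (rows : List (List Bool)) (l n j : ℕ) (c : List ℕ) :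
    ((swept M rows l n)^[j] c).length = c.length := by
  induction j with
  | zero => rfl
  | succ j ih => rw [Function.iterate_succ_apply', swept_length, ih]

theorem iterate_swept_sum (M : ℕ) (rows : List (List Bool)) (l n j : ℕ) (c : List ℕ) :
    ((swept M rows l n)^[j] c).sum = c.sum := by
  induction j with
  | zero => rfl
  | succ j ih => rw [Function.iterate_succ_apply', swept_sum, ih]

/-- After more sweeps than the rounded score can increase, no attempt is successful. -/
theorem trySwapped_iterate_swept {M : ℕ} {rows : List (List Bool)} {n j : ℕ} {c : List ℕ}
    (hj : rows.length * (c.sum * M) < j) {p q : ℕ} (hp : p < n) (hq : q < n) :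
    trySwapped M rows p q ((swept M rows n n)^[j] c) = (swept M rows n n)^[j] c := by
  have h : ∀ j, swept M rows n n ((swept M rows n n)^[j] c) = (swept M rows n n)^[j] c ∨
      j ≤ roundedScore M rows ((swept M rows n n)^[j] c) := by
    intro j
    induction j with
    | zero => exact .inr (Nat.zero_le _)
    | succ j ih =>
      rw [Function.iterate_succ_apply']
      rcases ih with h1 | h1
      · rw [h1]; exact .inl h1
      · rcases swept_eq_or_lt M rows n n ((swept M rows n n)^[j] c) with ⟨h2, _⟩ | h2
        · rw [h2]; exact .inl h2
        · exact .inr (by omega)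
  have h1 : swept M rows n n ((swept M rows n n)^[j] c) = (swept M rows n n)^[j] c := by
    refine (h j).resolve_right fun h1 => ?_
    have h2 := roundedScore_le M rows ((swept M rows n n)^[j] c)
    rw [iterate_swept_sum] at h2
    omega
  rcases swept_eq_or_lt M rows n n ((swept M rows n n)^[j] c) with ⟨_, h2⟩ | h2
  · exact h2 p hp q hq
  · rw [h1] at h2; exact absurd h2 (lt_irrefl _)

end LocalSearch

/-! ### Swaps in party-approval elections -/

namespace PartyElection

variable (e : PartyElection)

/-- The committee that results from `W` if one seat goes from party `p` to party `q`. This is meant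
for `0 < W p`; otherwise truncated subtraction makes it a committee with an additional seat. -/
def swap (W : e.Committee) (p q : Fin e.m) : e.Committee :=
  fun r => (if r = p then W r - 1 else W r) + if r = q then 1 else 0

/-- The PAV score of a committee over parties. -/
def partyScore (W : e.Committee) : ℚ := ∑ i, harmonic (e.utility W i)

variable {e}

theorem utility_swap {W : e.Committee} {p : Fin e.m} (hp : 0 < W p) (q : Fin e.m) (i : Fin e.n) :
    e.utility (e.swap W p q) i + (if p ∈ e.ballot i then 1 else 0) =
      e.utility W i + if q ∈ e.ballot i then 1 else 0 := by
  have h1 : ∑ r ∈ e.ballot i, (if r = p then W r - 1 else W r) +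
      (if p ∈ e.ballot i then 1 else 0) = ∑ r ∈ e.ballot i, W r := by
    rw [← Finset.sum_ite_eq' (e.ballot i) p fun _ => 1, ← Finset.sum_add_distrib]
    refine Finset.sum_congr rfl fun r _ => ?_
    split_ifs with h
    · subst h; omega
    · rfl
  have h2 : ∑ r ∈ e.ballot i, (if r = q then 1 else 0) = if q ∈ e.ballot i then 1 else 0 :=
    Finset.sum_ite_eq' (e.ballot i) q fun _ => 1
  simp only [utility, swap, Finset.sum_add_distrib, h2]
  omega

/-- The change of a voter's contribution to the PAV score by a swap: first the new seat is added,
and then the old one is removed. -/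
theorem harmonic_utility_swap {W : e.Committee} {p : Fin e.m} (hp : 0 < W p) (q : Fin e.m)
    (i : Fin e.n) :
    harmonic (e.utility (e.swap W p q) i) = harmonic (e.utility W i) +
      (if q ∈ e.ballot i then 1 / ((e.utility W i : ℚ) + 1) else 0) -
      (if p ∈ e.ballot i then
        1 / ((e.utility W i : ℚ) + if q ∈ e.ballot i then 1 else 0) else 0) := by
  have h := utility_swap hp q i
  by_cases hpi : p ∈ e.ballot i <;> by_cases hqi : q ∈ e.ballot i <;>
    simp only [hpi, hqi, if_true, if_false, add_zero] at h ⊢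
  · rw [Nat.add_right_cancel h]; ring
  · rw [← h, harmonic_succ]; push_cast; ring
  · rw [h, harmonic_succ]; push_cast; ring
  · rw [h]; ring

/-- Double counting: the seats of a committee, weighted by the weights of the voters that approve
them. -/
theorem sum_mul_sum_ite (T : e.Committee) (f : Fin e.n → ℚ) :
    ∑ q, (T q : ℚ) * ∑ i, (if q ∈ e.ballot i then f i else 0) =
      ∑ i, (e.utility T i : ℚ) * f i := by
  simp only [Finset.mul_sum]
  rw [Finset.sum_comm]
  refine Finset.sum_congr rfl fun i _ => ?_
  simp only [mul_ite, mul_zero, utility, Nat.cast_sum, Finset.sum_mul]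
  rw [← Finset.sum_filter]
  refine Finset.sum_congr ?_ fun _ _ => rfl
  ext; simp

/-- A committee is core stable if no swap increases its PAV score by `1 / k ^ 2`. If a group of
`s` voters deviates to a committee with at most `k s / n` seats, then one of these seats has a
marginal contribution of at least `n / k`. If it is added to the committee, the removal of the old
seats costs at most `n - n / k` in total, so that some swap gains at least `n / k ^ 2`. -/
theorem coreStable_of_swap {W : e.Committee} (hk : 0 < e.k) (hW : e.size W = e.k)
    (h : ∀ p q, 0 < W p → e.partyScore (e.swap W p q) < e.partyScore W + 1 / (e.k : ℚ) ^ 2) :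
    e.CoreStable W := by
  rintro ⟨S, hS, T, hT, hST⟩
  have hk' : (0 : ℚ) < e.k := by exact_mod_cast hk
  have hn : 0 < e.n := Fin.pos hS.choose
  have hn' : (1 : ℚ) ≤ e.n := by exact_mod_cast hn
  set u : Fin e.n → ℚ := fun i => (e.utility W i : ℚ) with hu
  have hu0 : ∀ i, 0 ≤ u i := fun i => Nat.cast_nonneg _
  set d : Fin e.m → ℚ := fun q => ∑ i, if q ∈ e.ballot i then 1 / (u i + 1) else 0 with hd
  have hsize : e.n * e.size T ≤ e.k * S.card := by
    rw [quota, Nat.le_div_iff_mul_le hn] at hT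
    rw [Nat.mul_comm]; exact hT
  have hsize' : (e.n : ℚ) * ∑ q, (T q : ℚ) ≤ e.k * S.card := by
    have : ((e.n * e.size T : ℕ) : ℚ) ≤ ((e.k * S.card : ℕ) : ℚ) := by exact_mod_cast hsize
    simpa [size] using this
  have hTd : (S.card : ℚ) ≤ ∑ q, (T q : ℚ) * d q := by
    rw [hd, sum_mul_sum_ite]
    calc (S.card : ℚ) = ∑ i ∈ S, 1 := by simp
      _ ≤ ∑ i ∈ S, (e.utility T i : ℚ) * (1 / (u i + 1)) := by
        refine Finset.sum_le_sum fun i hi => ?_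
        have h1 : u i + 1 ≤ e.utility T i := by
          change (e.utility W i : ℚ) + 1 ≤ e.utility T i
          exact_mod_cast hST i hi
        rw [mul_one_div, le_div_iff₀ (by linarith [hu0 i])]
        linarith
      _ ≤ _ := Finset.sum_le_sum_of_subset_of_nonneg (Finset.subset_univ _) fun i _ _ =>
        mul_nonneg (Nat.cast_nonneg _) (one_div_nonneg.mpr (by linarith [hu0 i]))
  obtain ⟨q, hq⟩ : ∃ q, (e.n : ℚ) ≤ e.k * d q := by
    by_contra! hlt
    have hTpos : ∃ q ∈ Finset.univ, (T q : ℚ) * (e.k * d q) < T q * e.n := by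
      obtain ⟨i, hi⟩ := hS
      have h1 : 0 < e.utility T i := (Nat.zero_le _).trans_lt (hST i hi)
      obtain ⟨q, _, hq⟩ := Finset.exists_ne_zero_of_sum_ne_zero h1.ne'
      refine ⟨q, Finset.mem_univ _, mul_lt_mul_of_pos_left (hlt q) ?_⟩
      exact_mod_cast Nat.pos_of_ne_zero hq
    have h1 := Finset.sum_lt_sum
      (fun q _ => mul_le_mul_of_nonneg_left (hlt q).le (Nat.cast_nonneg (T q))) hTpos
    have h2 : ∑ q, (T q : ℚ) * (e.k * d q) = e.k * ∑ q, (T q : ℚ) * d q := by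
      rw [Finset.mul_sum]; exact Finset.sum_congr rfl fun _ _ => by ring
    rw [h2, ← Finset.sum_mul] at h1
    nlinarith [mul_le_mul_of_nonneg_left hTd hk'.le]
  -- the gains of the swaps to `q`, weighted by the seats that are given up
  set g : Fin e.m → ℚ := fun p => d q -
    ∑ i, if p ∈ e.ballot i then 1 / (u i + if q ∈ e.ballot i then 1 else 0) else 0 with hg
  have hswap : ∀ p, 0 < W p → g p < 1 / (e.k : ℚ) ^ 2 := by
    intro p hp
    have h1 := h p q hp
    have h2 : e.partyScore (e.swap W p q) = e.partyScore W + g p := by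
      simp only [partyScore, harmonic_utility_swap hp, Finset.sum_sub_distrib,
        Finset.sum_add_distrib, hg, hd, hu]
      ring
    linarith
  have hWsum : ∑ p, (W p : ℚ) = e.k := by
    rw [← hW, size]; push_cast; rfl
  have hgain : ∑ p, (W p : ℚ) * g p < 1 / e.k := by
    obtain ⟨p₀, _, hp₀⟩ := Finset.exists_ne_zero_of_sum_ne_zero (hW.trans_ne hk.ne')
    have hp₀ := Nat.pos_of_ne_zero hp₀
    calc ∑ p, (W p : ℚ) * g p < ∑ p, (W p : ℚ) * (1 / (e.k : ℚ) ^ 2) := by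
          refine Finset.sum_lt_sum (fun p _ => ?_) ⟨p₀, Finset.mem_univ _,
            mul_lt_mul_of_pos_left (hswap p₀ hp₀) (by exact_mod_cast hp₀)⟩
          rcases Nat.eq_zero_or_pos (W p) with h0 | h0
          · simp [h0]
          · exact mul_le_mul_of_nonneg_left (hswap p h0).le (Nat.cast_nonneg _)
      _ = 1 / e.k := by rw [← Finset.sum_mul, hWsum]; field_simp
  have hgain' : ∑ p, (W p : ℚ) * g p = e.k * d q - ∑ i, u i * (1 / (u i +
      if q ∈ e.ballot i then 1 else 0)) := by
    rw [← sum_mul_sum_ite]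
    simp only [hg, mul_sub, Finset.sum_sub_distrib]
    rw [← Finset.sum_mul, hWsum]
  have hloss : ∑ i, u i * (1 / (u i + if q ∈ e.ballot i then 1 else 0)) ≤ e.n - d q := by
    have h1 : (e.n : ℚ) - d q =
        ∑ i : Fin e.n, (1 - if q ∈ e.ballot i then 1 / (u i + 1) else 0) := by
      simp [hd]
    rw [h1]
    refine Finset.sum_le_sum fun i _ => ?_
    have := hu0 i
    split_ifs
    · apply le_of_eq
      field_simp
      ring
    · rw [mul_one_div, add_zero, sub_zero]
      exact div_self_le_one _
  have hdq : 1 / (e.k : ℚ) ≤ d q := by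
    rw [div_le_iff₀ hk']; linarith
  linarith

theorem coreStable_of_k_eq_zero (hk : e.k = 0) (W : e.Committee) : e.CoreStable W := by
  rintro ⟨S, ⟨i, hi⟩, T, hT, hST⟩
  have h1 : e.size T = 0 := by simpa [quota, hk] using hT
  have h2 : e.utility T i ≤ e.size T :=
    Finset.sum_le_sum_of_subset (f := T) (Finset.subset_univ _)
  have := hST i hi
  omega

/-! ### Clones -/

theorem size_ofClones (X : Finset (Fin e.m × Fin e.k)) : e.size (e.ofClones X) = X.card :=
  (Finset.card_eq_sum_card_fiberwise fun _ _ => Finset.mem_coe.mpr (Finset.mem_univ _)).symm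

theorem utility_ofClones (X : Finset (Fin e.m × Fin e.k)) (i : Fin e.n) :
    e.utility (e.ofClones X) i = (X ∩ e.cloneBallot i).card := by
  rw [utility, Finset.card_eq_sum_card_fiberwise (f := Prod.fst) (t := e.ballot i)]
  · refine Finset.sum_congr rfl fun p hp => ?_
    rw [ofClones]
    congr 1
    ext c
    simp only [Finset.mem_filter, Finset.mem_inter, cloneBallot, Finset.mem_product,
      Finset.mem_univ, and_true]
    constructor
    · rintro ⟨h1, rfl⟩; exact ⟨⟨h1, hp⟩, rfl⟩
    · rintro ⟨⟨h1, _⟩, h2⟩; exact ⟨h1, h2⟩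
  · intro c hc
    exact (Finset.mem_product.mp (Finset.mem_inter.mp hc).2).1

theorem pavScore_cloneBallot (X : Finset (Fin e.m × Fin e.k)) :
    CandidateApproval.pavScore e.cloneBallot X = e.partyScore (e.ofClones X) := by
  simp only [CandidateApproval.pavScore, partyScore, utility_ofClones]

theorem ofClones_insert_erase {X : Finset (Fin e.m × Fin e.k)} {c c' : Fin e.m × Fin e.k}
    (hc : c ∈ X) (hc' : c' ∉ X) :
    e.ofClones (insert c' (X.erase c)) = e.swap (e.ofClones X) c.1 c'.1 := by
  funext r
  have hc'' : c' ∉ (X.erase c).filter (fun x => x.1 = r) := by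
    simp [hc']
  simp only [ofClones, swap, Finset.filter_insert]
  rw [Finset.filter_erase]
  rw [Finset.filter_erase] at hc''
  by_cases h : r = c.1 <;> by_cases h' : r = c'.1
  · rw [if_pos h'.symm, Finset.card_insert_of_notMem hc'', if_pos h, if_pos h',
      Finset.card_erase_of_mem (by simp [hc, h])]
  · rw [if_neg (Ne.symm h'), if_pos h, if_neg h',
      Finset.card_erase_of_mem (by simp [hc, h]), add_zero]
  · rw [if_pos h'.symm, Finset.card_insert_of_notMem hc'', if_neg h, if_pos h',
      Finset.erase_eq_of_notMem (by simp [Ne.symm h])]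
  · rw [if_neg (Ne.symm h'), if_neg h, if_neg h',
      Finset.erase_eq_of_notMem (by simp [Ne.symm h]), add_zero]

theorem lsStep_card {X Y : Finset (Fin e.m × Fin e.k)} {ε : ℚ}
    (h : CandidateApproval.LSStep e.cloneBallot ε X Y) : Y.card = X.card := by
  obtain ⟨c, hc, c', hc', rfl, _⟩ := h
  rw [Finset.card_insert_of_notMem (by simp [hc']), Finset.card_erase_of_mem hc]
  have := Finset.card_pos.mpr ⟨c, hc⟩
  omega

theorem reflTransGen_lsStep_card {X Y : Finset (Fin e.m × Fin e.k)} {ε : ℚ}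
    (h : Relation.ReflTransGen (CandidateApproval.LSStep e.cloneBallot ε) X Y) :
    Y.card = X.card := by
  induction h with
  | refl => rfl
  | tail _ h ih => rw [lsStep_card h, ih]

/-- The clones of a committee of size `k` that has no swap that gains `ε` form a possible result of
local search: this is the case in which the local search starts from this committee. -/
theorem exists_isLSPAVOutcome {W : e.Committee} (hW : e.size W = e.k) {ε : ℚ}
    (h : ∀ p q, 0 < W p → e.partyScore (e.swap W p q) < e.partyScore W + ε) :
    ∃ X, CandidateApproval.IsLSPAVOutcome e.cloneBallot e.k ε X ∧ W = e.ofClones X := by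
  have hle : ∀ p, W p ≤ e.k := fun p =>
    (Finset.single_le_sum (f := W) (fun _ _ => Nat.zero_le _) (Finset.mem_univ p)).trans_eq hW
  set X : Finset (Fin e.m × Fin e.k) := Finset.univ.filter fun c => c.2.1 < W c.1 with hX
  have hWX : W = e.ofClones X := by
    funext p
    have : X.filter (fun c => c.1 = p) =
        (Finset.univ.filter fun j : Fin e.k => j.1 < W p).map ⟨fun j => (p, j), fun _ _ h =>
          (Prod.ext_iff.mp h).2⟩ := by
      ext ⟨r, j⟩
      simp [hX]
      constructor
      · rintro ⟨h1, rfl⟩; exact ⟨j, h1, rfl⟩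
      · rintro ⟨j', h1, h2⟩; cases h2; exact ⟨h1, rfl⟩
    rw [ofClones, this, Finset.card_map, Fin.card_filter_val_lt, min_eq_right (hle p)]
  refine ⟨X, ⟨X, ?_, .refl, ?_⟩, hWX⟩
  · rw [← size_ofClones, ← hWX, hW]
  · rintro Y ⟨c, hc, c', hc', rfl, hgain⟩
    rw [pavScore_cloneBallot, pavScore_cloneBallot, ofClones_insert_erase hc hc', ← hWX] at hgain
    have hpos : 0 < W c.1 := by
      have := (Finset.mem_filter.mp hc).2
      omega
    exact absurd (h c.1 c'.1 hpos) (not_lt.mpr hgain)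

/-- At a possible result of local search, no swap of seats between parties gains `ε`. -/
theorem partyScore_swap_lt {X : Finset (Fin e.m × Fin e.k)} {ε : ℚ} (hε : 0 < ε)
    (hX : CandidateApproval.IsLSPAVOutcome e.cloneBallot e.k ε X) (p q : Fin e.m)
    (hp : 0 < e.ofClones X p) :
    e.partyScore (e.swap (e.ofClones X) p q) < e.partyScore (e.ofClones X) + ε := by
  obtain ⟨X₀, hcard, hreach, hopt⟩ := hX
  rw [← reflTransGen_lsStep_card hreach] at hcard
  obtain ⟨c, hcp⟩ := Finset.card_pos.mp hp
  obtain ⟨hc, rfl⟩ := Finset.mem_filter.mp hcp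
  rcases eq_or_ne c.1 q with rfl | hne
  · have : e.swap (e.ofClones X) c.1 c.1 = e.ofClones X := by
      funext r
      by_cases h : r = c.1
      · subst h; simp [swap]; omega
      · simp [swap, h]
    rw [this]
    linarith
  -- not all clones of `q` belong to `X`, since `X` has `k` elements and one is a clone of `p`
  obtain ⟨c', hc', rfl⟩ : ∃ c', c' ∉ X ∧ c'.1 = q := by
    by_contra! hall
    have h1 : insert c ((Finset.univ : Finset (Fin e.k)).map ⟨fun j => (q, j), fun _ _ h =>
        (Prod.ext_iff.mp h).2⟩) ⊆ X := by
      intro x hx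
      rcases Finset.mem_insert.mp hx with rfl | hx
      · exact hc
      · obtain ⟨j, _, rfl⟩ := Finset.mem_map.mp hx
        by_contra h
        exact hall _ h rfl
    have h2 := Finset.card_le_card h1
    rw [Finset.card_insert_of_notMem, Finset.card_map, Finset.card_univ, Fintype.card_fin] at h2
    · omega
    · rintro hx
      obtain ⟨j, _, rfl⟩ := Finset.mem_map.mp hx
      exact hne rfl
  by_contra! hge
  refine hopt _ ⟨c, hc, c', hc', rfl, ?_⟩
  rwa [pavScore_cloneBallot, pavScore_cloneBallot, ofClones_insert_erase hc hc']

theorem threshold_pos (hk : 2 ≤ e.k) : 0 < e.threshold := by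
  have : (2 : ℚ) ≤ e.k := by exact_mod_cast hk
  rw [threshold]
  have h1 : 0 < (e.k : ℚ) - 1 := by linarith
  positivity

/-- Local search with the threshold stops only at committees to which `coreStable_of_swap`
applies. -/
theorem threshold_le (hk : 2 ≤ e.k) : e.threshold ≤ 1 / (e.k : ℚ) ^ 2 := by
  have : (2 : ℚ) ≤ e.k := by exact_mod_cast hk
  rw [threshold]
  refine one_div_le_one_div_of_le (by positivity) ?_
  nlinarith [mul_nonneg (sub_nonneg.mpr this) (sub_nonneg.mpr this)]

theorem coreStable_of_isLSPAVOutcome (hk : 2 ≤ e.k) {X : Finset (Fin e.m × Fin e.k)}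
    (hX : CandidateApproval.IsLSPAVOutcome e.cloneBallot e.k e.threshold X) :
    e.CoreStable (e.ofClones X) := by
  refine coreStable_of_swap (by omega) ?_ fun p q hp =>
    (partyScore_swap_lt (threshold_pos hk) hX p q hp).trans_le
      (add_le_add_right (threshold_le hk) _)
  obtain ⟨X₀, hcard, hreach, _⟩ := hX
  rw [size_ofClones, reflTransGen_lsStep_card hreach, hcard]

/-! ### The number of iterations of local search -/

theorem harmonic_mono : Monotone harmonic :=
  monotone_nat_of_le_succ fun n => by
    rw [harmonic_succ]
    exact le_add_of_nonneg_right (by positivity)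

/-- Each iteration gains the threshold, and the score never exceeds `n` times the harmonic number
of `k`, which is at most `1 + log k`; the constant absorbs the `1`, as `k ≥ 2`. -/
theorem run_length_le (hk : 2 ≤ e.k) {L : ℕ} {w : Fin (L + 1) → Finset (Fin e.m × Fin e.k)}
    (hw : CandidateApproval.IsLSPAVRun e.cloneBallot e.k e.threshold L w) :
    (L : ℝ) ≤ (2 * (1 + 1 / Real.log 2)) * e.n * (e.k : ℝ) ^ 3 * Real.log e.k := by
  obtain ⟨h0, hstep⟩ := hw
  have hinv : ∀ j : Fin (L + 1), (w j).card = e.k ∧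
      (j.1 : ℚ) * e.threshold ≤ CandidateApproval.pavScore e.cloneBallot (w j) := by
    intro j
    induction j using Fin.induction with
    | zero =>
      refine ⟨h0, ?_⟩
      simp only [Fin.val_zero, Nat.cast_zero, zero_mul]
      exact Finset.sum_nonneg fun i _ => harmonic_mono (Nat.zero_le _)
    | succ j ih =>
      refine ⟨(lsStep_card (hstep j)).trans ih.1, ?_⟩
      obtain ⟨c, _, c', _, _, hle⟩ := hstep j
      have := ih.2
      simp only [Fin.val_castSucc, Fin.val_succ] at this ⊢
      push_cast
      linarith
  obtain ⟨hcard, hscore⟩ := hinv (Fin.last L)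
  have hk' : (2 : ℝ) ≤ e.k := by exact_mod_cast hk
  have hupper : CandidateApproval.pavScore e.cloneBallot (w (Fin.last L)) ≤ e.n * harmonic e.k := by
    calc _ ≤ ∑ _i : Fin e.n, harmonic e.k := Finset.sum_le_sum fun i _ =>
          harmonic_mono ((Finset.card_le_card Finset.inter_subset_left).trans_eq hcard)
      _ = _ := by simp
  have hL : (L : ℚ) * e.threshold ≤ e.n * harmonic e.k := hscore.trans hupper
  have hL' : (L : ℝ) * (1 / ((1 + 2 * ((e.k : ℝ) - 1)) * ((e.k : ℝ) - 1) * (e.k : ℝ))) ≤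
      e.n * (harmonic e.k : ℝ) := by
    have : (((L : ℚ) * e.threshold : ℚ) : ℝ) ≤ ((e.n * harmonic e.k : ℚ) : ℝ) := by
      exact_mod_cast hL
    rw [threshold] at this
    push_cast at this
    exact this
  have hlog2 : 0 < Real.log 2 := Real.log_pos (by norm_num)
  have hlog : Real.log 2 ≤ Real.log e.k := Real.log_le_log (by norm_num) hk'
  have hH : (harmonic e.k : ℝ) ≤ (1 + 1 / Real.log 2) * Real.log e.k := by
    have h1 := harmonic_le_one_add_log e.k
    have h2 : 1 ≤ 1 / Real.log 2 * Real.log e.k := by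
      rw [one_div_mul_eq_div, le_div_iff₀ hlog2]; linarith
    linarith
  have hD : 0 < (1 + 2 * ((e.k : ℝ) - 1)) * ((e.k : ℝ) - 1) * (e.k : ℝ) := by
    have h1 : 0 < (e.k : ℝ) - 1 := by linarith
    positivity
  have hD' : (1 + 2 * ((e.k : ℝ) - 1)) * ((e.k : ℝ) - 1) * (e.k : ℝ) ≤ 2 * (e.k : ℝ) ^ 3 := by
    nlinarith [sq_nonneg (e.k : ℝ)]
  rw [mul_one_div, div_le_iff₀ hD] at hL'
  calc (L : ℝ) ≤ _ := hL'
    _ ≤ e.n * ((1 + 1 / Real.log 2) * Real.log e.k) * (2 * (e.k : ℝ) ^ 3) := by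
      gcongr
    _ = _ := by ring

end PartyElection

namespace LocalSearch

/-! ### Elections as lists -/

theorem sum_ofFn_nat {m : ℕ} (W : Fin m → ℕ) : (List.ofFn W).sum = ∑ p, W p := List.sum_ofFn

theorem dot_ofFn {m : ℕ} (b : Fin m → Bool) (W : Fin m → ℕ) :
    dot (List.ofFn b) (List.ofFn W) = ∑ p, if b p then W p else 0 := by
  induction m with
  | zero => simp [dot]
  | succ m ih => simp [List.ofFn_succ, dot, Fin.sum_univ_succ, ih]

/-- On the unary encodings of two parties, `swapped` moves one seat between them. -/
theorem swapped_getD (p q : ℕ) (c : List ℕ) (r : ℕ) (hr : r < c.length) :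
    (swapped (unary p) (unary q) c).getD r 0 =
      (if r = p then c.getD r 0 - 1 else c.getD r 0) + if r = q then 1 else 0 := by
  -- the contents of the stacks after some steps: either still unary or used up
  have h : ∀ (c : List ℕ) (P Q : List (Option Bool)) (p' q' : ℕ → Prop) [DecidablePred p']
      [DecidablePred q'] (r : ℕ), (∀ j, (P.drop j).head? = some sep ↔ p' j) →
      (∀ j, (Q.drop j).head? = some sep ↔ q' j) → r < c.length →
      (swapped P Q c).getD r 0 =
        (if p' r then c.getD r 0 - 1 else c.getD r 0) + if q' r then 1 else 0 := by
    intro c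
    induction c with
    | nil => intro _ _ _ _ _ _ r _ _ hr; simp at hr
    | cons n c ih =>
      intro P Q p' q' _ _ r hP hQ hr
      cases r with
      | zero =>
        have h1 := hP 0
        have h2 := hQ 0
        simp only [List.drop_zero] at h1 h2
        simp [swapped, h1, h2]
      | succ r =>
        have := ih P.tail Q.tail (fun j => p' (j + 1)) (fun j => q' (j + 1)) r
          (fun j => by rw [← hP, List.drop_tail]) (fun j => by rw [← hQ, List.drop_tail])
          (by simpa using hr)
        simpa [swapped] using this
  have h2 : ∀ p j : ℕ, ((unary p).drop j).head? = some sep ↔ j = p := by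
    intro p j
    induction p generalizing j with
    | zero => cases j <;> simp [unary]
    | succ p ih =>
      cases j with
      | zero => simp [unary_succ, one, sep]
      | succ j => rw [unary_succ, List.drop_succ_cons, ih]; simp
  exact h c (unary p) (unary q) (· = p) (· = q) r (h2 p) (h2 q) hr

theorem enc_ofFn {m : ℕ} (W : Fin m → ℕ) : encodeCommittee ⟨m, W⟩ = enc (List.ofFn W) := by
  simp only [encodeCommittee, enc, List.flatMap, List.map_ofFn]
  rfl

end LocalSearch

namespace PartyElection

open LocalSearch

/-- The approval matrix of an election. -/
def rows (e : PartyElection) : List (List Bool) :=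
  List.ofFn fun i => List.ofFn fun p => decide (p ∈ e.ballot i)

variable {e : PartyElection}

theorem encode_eq : e.encode = List.replicate e.k one ++
    sep :: (List.replicate e.m one ++ sep :: encRows e.rows) := by
  simp [encode, encRows, rows, List.flatMap, List.map_ofFn, one, sep, Function.comp_def]

theorem length_encode : e.encode.length = e.k + e.m + 2 + e.n * (e.m + 1) := by
  simp only [encode, List.length_append, List.length_replicate, List.length_cons,
    List.length_flatten, List.map_ofFn, Function.comp_def, List.length_ofFn,
    List.ofFn_const, List.sum_replicate, smul_eq_mul, List.length_nil]
  ring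

theorem dot_rows (W : e.Committee) (i : Fin e.n) :
    dot (List.ofFn fun p => decide (p ∈ e.ballot i)) (List.ofFn W) = e.utility W i := by
  rw [dot_ofFn, utility]
  simp [Finset.sum_ite_mem]

/-- The integer approximation of `M` times the PAV score. -/
def roundedPartyScore (e : PartyElection) (M : ℕ) (W : e.Committee) : ℕ :=
  ∑ i, roundedHarmonic M (e.utility W i)

theorem roundedScore_rows (M : ℕ) (W : e.Committee) :
    roundedScore M e.rows (List.ofFn W) = e.roundedPartyScore M W := by
  simp only [roundedScore, rows, List.map_ofFn, Function.comp_def, dot_rows, List.sum_ofFn,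
    roundedPartyScore]

theorem ofFn_swap (W : e.Committee) (p q : Fin e.m) :
    List.ofFn (e.swap W p q) = swapped (unary p) (unary q) (List.ofFn W) := by
  refine List.ext_getElem (by simp [swapped_length]) fun r h1 h2 => ?_
  have hr : r < e.m := by simpa using h1
  have := swapped_getD p q (List.ofFn W) r (by simpa using hr)
  rw [List.getD_eq_getElem _ _ h2] at this
  rw [this]
  simp [swap, hr, Fin.ext_iff]

/-- Rounding changes the value of a voter by less than one unit per swap, since at most one summand
of the harmonic number is concerned. -/
theorem mul_partyScore_swap_le (M : ℕ) {W : e.Committee} {p : Fin e.m} (hp : 0 < W p)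
    (q : Fin e.m) :
    M * (e.partyScore (e.swap W p q) - e.partyScore W) ≤
      (e.roundedPartyScore M (e.swap W p q) : ℚ) - e.roundedPartyScore M W + e.n := by
  have h1 : ∀ i, M * (harmonic (e.utility (e.swap W p q) i) - harmonic (e.utility W i)) ≤
      (roundedHarmonic M (e.utility (e.swap W p q) i) : ℚ) - roundedHarmonic M (e.utility W i)
        + 1 := by
    intro i
    have hsucc : ∀ u, roundedHarmonic M (u + 1) = roundedHarmonic M u + M / (u + 1) :=
      fun u => Finset.sum_range_succ _ _
    have hle : ∀ u : ℕ, ((M / (u + 1) : ℕ) : ℚ) ≤ M * ((u + 1 : ℕ) : ℚ)⁻¹ := fun u => by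
      rw [← div_eq_mul_inv]; exact Nat.cast_div_le
    have hge : ∀ u : ℕ, M * ((u + 1 : ℕ) : ℚ)⁻¹ ≤ ((M / (u + 1) : ℕ) : ℚ) + 1 := fun u => by
      rw [← div_eq_mul_inv, div_le_iff₀ (by positivity)]
      have := Nat.lt_div_mul_add (a := M) (b := u + 1) (Nat.succ_pos u)
      have h3 : M ≤ (M / (u + 1) + 1) * (u + 1) := by linarith
      exact_mod_cast h3
    have h := utility_swap hp q i
    by_cases hpi : p ∈ e.ballot i <;> by_cases hqi : q ∈ e.ballot i <;>
      simp only [hpi, hqi, if_true, if_false, add_zero] at h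
    · rw [Nat.add_right_cancel h]; simp
    · rw [← h, harmonic_succ, hsucc]
      have := hle (e.utility (e.swap W p q) i)
      push_cast at this ⊢
      linarith
    · rw [h, harmonic_succ, hsucc]
      have := hge (e.utility W i)
      push_cast at this ⊢
      linarith
    · rw [h]; simp
  have h2 := Finset.sum_le_sum fun i (_ : i ∈ Finset.univ) => h1 i
  simp only [← Finset.mul_sum, Finset.sum_sub_distrib, Finset.sum_add_distrib] at h2
  simpa [partyScore, roundedPartyScore] using h2

/-- The committee that is computed, as a list: the rounded score with `M = N ^ 4` is improved in
`N ^ 6` sweeps, where `N` is the length of the input. -/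
def computedList (e : PartyElection) : List ℕ :=
  (swept (e.encode.length ^ 4) e.rows e.encode.length e.encode.length)^[e.encode.length ^ 6]
    (e.k :: List.replicate (e.m - 1) 0)

/-- The committee that is computed: the result of local search for the rounded score. -/
def computed (e : PartyElection) : e.Committee := fun p => e.computedList.getD p 0

theorem length_computedList : e.computedList.length = e.m := by
  have := e.m_pos
  rw [computedList, iterate_swept_length]
  simp
  omega

theorem ofFn_computed : List.ofFn e.computed = e.computedList := by
  refine List.ext_getElem (by simp [length_computedList]) fun r h1 h2 => ?_
  simp [computed, h2]

theorem size_computed : e.size e.computed = e.k := by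
  rw [size, ← sum_ofFn_nat, ofFn_computed, computedList, iterate_swept_sum]
  simp

theorem roundedPartyScore_swap_computed {p q : Fin e.m} (hp : 0 < e.computed p) :
    e.roundedPartyScore (e.encode.length ^ 4) (e.swap e.computed p q) ≤
      e.roundedPartyScore (e.encode.length ^ 4) e.computed := by
  have hlen := length_encode (e := e)
  have hm := e.m_pos
  have hn : e.n ≤ e.n * (e.m + 1) := Nat.le_mul_of_pos_right _ (Nat.succ_pos _)
  have h1 : e.rows.length * ((e.k :: List.replicate (e.m - 1) 0).sum * e.encode.length ^ 4) <
      e.encode.length ^ 6 := by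
    have h2 : e.rows.length = e.n := by simp [rows]
    have h3 : (e.k :: List.replicate (e.m - 1) 0).sum = e.k := by simp
    rw [h2, h3]
    calc e.n * (e.k * e.encode.length ^ 4) = e.n * e.k * e.encode.length ^ 4 := by ring
      _ < e.encode.length * e.encode.length * e.encode.length ^ 4 := by
        refine Nat.mul_lt_mul_of_pos_right ?_ (pow_pos (by omega) _)
        exact Nat.mul_lt_mul'' (by omega) (by omega)
      _ = _ := by ring
  have h2 := trySwapped_iterate_swept h1 (p := p) (q := q) (n := e.encode.length)
    (by omega) (by omega)
  rw [← computedList, ← ofFn_computed, trySwapped] at h2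
  by_contra! hlt
  rw [if_pos ⟨by simpa using hp, by simp, by rwa [← ofFn_swap, roundedScore_rows,
    roundedScore_rows]⟩, ← ofFn_swap] at h2
  rw [List.ofFn_injective h2] at hlt
  exact lt_irrefl _ hlt

/-- At the computed committee, the gain of a swap comes from rounding only. -/
theorem partyScore_swap_computed_lt {p q : Fin e.m} (hp : 0 < e.computed p) {D : ℕ}
    (hD : e.n * D < e.encode.length ^ 4) (hD' : 0 < D) :
    e.partyScore (e.swap e.computed p q) < e.partyScore e.computed + 1 / D := by
  have h1 := mul_partyScore_swap_le (e.encode.length ^ 4) hp q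
  have h2 : (e.roundedPartyScore (e.encode.length ^ 4) (e.swap e.computed p q) : ℚ) ≤
      e.roundedPartyScore (e.encode.length ^ 4) e.computed := by
    exact_mod_cast roundedPartyScore_swap_computed hp
  have h3 : ((e.n * D : ℕ) : ℚ) < (e.encode.length ^ 4 : ℕ) := by exact_mod_cast hD
  have hD'' : (0 : ℚ) < D := by exact_mod_cast hD'
  have hN : (0 : ℚ) < (e.encode.length ^ 4 : ℕ) := (Nat.cast_nonneg _).trans_lt h3
  rw [← sub_lt_iff_lt_add', lt_div_iff₀ hD'']
  refine lt_of_mul_lt_mul_left ?_ hN.le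
  push_cast at h1 h3 hN ⊢
  nlinarith

theorem coreStable_computed : e.CoreStable e.computed := by
  rcases Nat.eq_zero_or_pos e.k with hk | hk
  · exact coreStable_of_k_eq_zero hk _
  · refine coreStable_of_swap hk size_computed fun p q hp => ?_
    have hlen := length_encode (e := e)
    have hn : e.n ≤ e.n * (e.m + 1) := Nat.le_mul_of_pos_right _ (Nat.succ_pos _)
    have := partyScore_swap_computed_lt (q := q) hp (D := e.k ^ 2) ?_ (by positivity)
    · simpa using this
    · calc e.n * e.k ^ 2 < e.encode.length * e.encode.length ^ 2 :=
            Nat.mul_lt_mul'' (by omega) (Nat.pow_lt_pow_left (by omega) two_ne_zero)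
        _ = e.encode.length ^ 3 := by ring
        _ ≤ _ := Nat.pow_le_pow_right (by omega) (by norm_num)

theorem exists_isLSPAVOutcome_computed (hk : 2 ≤ e.k) :
    ∃ X, CandidateApproval.IsLSPAVOutcome e.cloneBallot e.k e.threshold X ∧
      e.computed = e.ofClones X := by
  refine exists_isLSPAVOutcome size_computed fun p q hp => ?_
  have hlen := length_encode (e := e)
  have hn : e.n * 2 ≤ e.n * (e.m + 1) := Nat.mul_le_mul_left _ (by have := e.m_pos; omega)
  obtain ⟨j, hj⟩ := Nat.exists_eq_add_of_le hk
  have h := partyScore_swap_computed_lt (q := q) hp (D := (1 + 2 * (j + 1)) * (j + 1) * e.k) ?_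
    (by positivity)
  · refine h.trans_eq ?_
    rw [threshold, hj]
    push_cast
    congr 2
    ring
  · calc e.n * ((1 + 2 * (j + 1)) * (j + 1) * e.k) ≤ e.n * ((2 * e.k) * e.k * e.k) := by
          gcongr <;> omega
      _ = (e.n * 2) * e.k ^ 3 := by ring
      _ < e.encode.length * e.encode.length ^ 3 :=
        Nat.mul_lt_mul'' (by omega) (Nat.pow_lt_pow_left (by omega) (by norm_num))
      _ = _ := by ring

theorem computableInPolyTime_computed :
    Nonempty (Turing.TM2ComputableInPolyTime encode encodeCommittee
      (fun e => (⟨e.m, e.computed⟩ : Σ m : ℕ, (Fin m → ℕ)))) := by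
  refine LoopProg.polyTime prog (inp := .mat) (tmp := .mat') .com (by decide) fun e => ?_
  rw [run_prog e.m_pos (rows := e.rows) ?_ e.encode encode_eq rfl, enc_ofFn, ofFn_computed]
  · rfl
  · intro r hr
    obtain ⟨i, rfl⟩ := (List.mem_ofFn' _ _).mp hr
    simp

end PartyElection

/-- A core-stable committee of size `k` can be computed in polynomial time (`k` in unary), and for
`k ≥ 2` as an outcome of local-search PAV with the threshold `1 / ((1 + 2(k-1))(k-1)k)`; every such
outcome is core stable, and the number of improving swaps is `O(n k³ log k)`. -/
theorem theorem4 :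
    (∃ F : (e : PartyElection) → e.Committee,
      Nonempty (Turing.TM2ComputableInPolyTime PartyElection.encode encodeCommittee
        (fun e => (⟨e.m, F e⟩ : Σ m : ℕ, (Fin m → ℕ)))) ∧
      ∀ e : PartyElection, e.size (F e) = e.k ∧ e.CoreStable (F e) ∧
        (2 ≤ e.k → ∃ X : Finset (Fin e.m × Fin e.k),
          CandidateApproval.IsLSPAVOutcome e.cloneBallot e.k e.threshold X ∧
            F e = e.ofClones X)) ∧
    (∀ e : PartyElection, 2 ≤ e.k → ∀ X : Finset (Fin e.m × Fin e.k),
      CandidateApproval.IsLSPAVOutcome e.cloneBallot e.k e.threshold X →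
        e.CoreStable (e.ofClones X)) ∧
    (∃ K : ℝ, ∀ e : PartyElection, 2 ≤ e.k →
      ∀ (L : ℕ) (w : Fin (L + 1) → Finset (Fin e.m × Fin e.k)),
        CandidateApproval.IsLSPAVRun e.cloneBallot e.k e.threshold L w →
          (L : ℝ) ≤ K * (e.n : ℝ) * (e.k : ℝ) ^ 3 * Real.log (e.k : ℝ)) := by
  refine ⟨⟨PartyElection.computed, PartyElection.computableInPolyTime_computed, fun e =>
    ⟨PartyElection.size_computed, PartyElection.coreStable_computed,
      PartyElection.exists_isLSPAVOutcome_computed⟩⟩,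
    fun e hk X hX => PartyElection.coreStable_of_isLSPAVOutcome hk hX,
    ⟨2 * (1 + 1 / Real.log 2), fun e hk L w hw => PartyElection.run_length_le hk hw⟩⟩
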